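/- Let $R$ be a commutative ring with group of units $R^\times$ and let $G$ be a group. Let $\mathcal R[G]$ be the category of $G$-graded free $R$-modules of finite total dimension and grading-preserving $R$-homomorphisms, with the standard product $(X\otimes Y)_f=\bigoplus_{gh=f}X_g\otimes Y_h$. All cochains are cellular with values in $R^\times$ (written multiplicatively). The bar construction $B_G$ has as $n$-cells the $n$-tuples in $G$, with boundary $\partial=\sum_{i=0}^n(-1)^i\partial_i$, where $\partial_0$ and $\partial_n$ omit the first and the last entry and $\partial_i$ multiplies the entries $i$ and $i+1$ for $0<i<n$. If $G$ is abelian, then $B_G$ has a product given by shuffles and one forms $B^2_G=B(B_G)$, with cells $\Delta^n\times(x_1\times\cdots\times x_n)$ for $x_i$ cells of $B_G$, and similarly $B^3_G=B(B^2_G)$; cochains on $B^2_G$ and $B^3_G$ are taken on the quotient of the cellular chain complex by the (contractible) subcomplex spanned by the cells having a $0$-cell of $B_G$ (or, for $B^3_G$, a $0$-cell of $B_G$ or $B^2_G$) as a factor. "Multiplication by $\alpha(a,b,c)$" means multiplication by this unit on the summand of degrees $a,b,c$. An associativity structure is a natural isomorphism $(X\otimes Y)\otimes Z\cong X\otimes(Y\otimes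 Z)$ satisfying the pentagon axiom. A braided structure is an associativity structure together with a natural isomorphism $X\otimes Y\cong Y\otimes X$ satisfying both hexagon axioms. It is symmetric if the composite $X\otimes Y\to Y\otimes X\to X\otimes Y$ is always the identity. Every associativity structure admits natural unit isomorphisms for the unit object $R$ in degree $1$ that satisfy the triangle axiom. It thus gives a monoidal structure on $\mathcal R[G]$, and a braided or symmetric structure gives a braided or symmetric monoidal structure. Moreover: 1. Sending a $3$-cocycle $\alpha$ on $B_G$ to the standard associativity isomorphism multiplied by $\alpha(a,b,c)$ is a bijection from the $3$-cocycles on $B_G$ to the associativity structures for the standard product on $\mathcal R[G]$. Sending a $2$-cochain $\mu$ to multiplication by $\mu(a,b)$ is a bijection from the $2$-cochains to the natural automorphisms of the product functor. Coboundaries of $2$-cochains are cocycles, and $\alpha'=\alpha\cdot\delta\mu$ if and only if the identity functor together with the natural automorphism $\mu$ carries the associativity $\alpha$ to $\alpha'$, i.e. $\mu_{X,Y\otimes Z}\circ(1_X\otimes\mu_{Y,Z})\circ\alpha_{X,Y,Z}=\alpha'_{X,Y,Z}\circ\mu_{X\otimes Y,Z}\circ(\mu_{X,Y}\otimes 1_Z)$.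 2. Suppose $G$ is abelian. A $4$-cochain on $B^2_G$ is a pair $(\alpha,\sigma)$, with $\alpha(a,b,c)$ its value on the cell $\Delta^1\times\Delta^3$ indexed by $(a,b,c)$ and $\sigma(a,b)$ its value on the cell $\Delta^2\times(\Delta^1\times\Delta^1)$ indexed by $((a),(b))$. Sending $(\alpha,\sigma)$ to the standard associativity isomorphism multiplied by $\alpha(a,b,c)$ and the standard commutativity isomorphism multiplied by $\sigma(a,b)^{-1}$ is a bijection from the $4$-cocycles on $B^2_G$ to the braided structures for the standard product on $\mathcal R[G]$. A $3$-cochain on $B^2_G$ is a function $\mu(a,b)$ (its values on the cells $\Delta^1\times\Delta^2$). Sending it to multiplication by $\mu(a,b)^{-1}$ is a bijection from the $3$-cochains to the natural automorphisms of the product functor. Coboundaries of $3$-cochains are cocycles, and $(\alpha',\sigma')=(\alpha,\sigma)\cdot\delta\mu$ if and only if the identity functor together with this natural automorphism carries the associativity and commutativity isomorphisms of $(\alpha,\sigma)$ to those of $(\alpha',\sigma')$. 3. Suppose $G$ is abelian. A $5$-cochain on $B^3_G$ is again a pair $(\alpha,\sigma)$ (its values on the products of $\Delta^1$ with the two kinds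 of $4$-cells of $B^2_G$ above). The same assignment as in 2 is a bijection from the $5$-cocycles on $B^3_G$ to the symmetric structures for the standard product on $\mathcal R[G]$. -/

import Mathlib

open CategoryTheory TensorProduct

universe u v

namespace GroupCat

noncomputable section

/-! ### Cellular chains of bar constructions -/

/-- The cellular data of a cell complex with a cellular multiplication: `S` is the set of (oriented)
cells, `dim` is the dimension of a cell, `bd` is the cellular boundary (in the free abelian group on
the cells), and `mul x y` is the cellular chain that is the image of the product cell `x × y` under
the multiplication. -/
structure CellData (S : Type v) where
  dim : S → ℕ
  bd : S → (S →₀ ℤ)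
  mul : S → S → (S →₀ ℤ)

namespace CellData

variable {S : Type v} (A : CellData S)

/-- Dimension of the product cell `x₁ × ⋯ × xₙ`. -/
def tupleDim (l : List S) : ℕ := (l.map A.dim).sum

/-- Boundary of the product cell `x₁ × ⋯ × xₙ`, by the rule
`∂(x × y) = ∂x × y + (-1)^(dim x) x × ∂y`. -/
def tupleBd : List S → (List S →₀ ℤ)
  | [] => 0
  | x :: l => (A.bd x).mapDomain (fun y => y :: l)
      + (-1 : ℤ) ^ A.dim x • (tupleBd l).mapDomain (fun m => x :: m)

/-- `face k l` is the cellular chain of the image of `∂ₖΔⁿ × x₁ × ⋯ × xₙ`, where `l = [x₁, …, xₙ]`: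
the zeroth face omits `x₁`, the `n`-th face omits `xₙ`, and for `0 < k < n` the entries `xₖ` and
`xₖ₊₁` are multiplied. Omitting an entry of positive dimension lowers the dimension of the image,
so that it contributes `0`. -/
def face : ℕ → List S → (List S →₀ ℤ)
  | _, [] => 0
  | 0, x :: l => if A.dim x = 0 then Finsupp.single l 1 else 0
  | 1, [x] => if A.dim x = 0 then Finsupp.single [] 1 else 0
  | 1, x :: y :: l => (A.mul x y).mapDomain (fun z => z :: l)
  | k + 2, x :: l => (face (k + 1) l).mapDomain (fun m => x :: m)

/-- Boundary of the cell `Δⁿ × (x₁ × ⋯ × xₙ)` of the bar construction. -/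
def barBd (l : List S) : List S →₀ ℤ :=
  (∑ k ∈ Finset.range (l.length + 1), (-1 : ℤ) ^ k • A.face k l)
    + (-1 : ℤ) ^ l.length • A.tupleBd l

/-- The sum over all shuffles of the two lists. The sign of a shuffle is its parity as a permutation
(the orientation of the simplex in `Δⁱ × Δʲ`), times the sign for permuting the product cells: moving
`y` in front of `x₁, …, xᵢ` gives `(-1)^i * (-1)^(dim y * (dim x₁ + ⋯ + dim xᵢ))`. -/
def shuffle : List S → List S → (List S →₀ ℤ)
  | [], l => Finsupp.single l 1
  | x :: l, [] => Finsupp.single (x :: l) 1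
  | x :: l, y :: m =>
      (shuffle l (y :: m)).mapDomain (fun t => x :: t)
        + (-1 : ℤ) ^ ((x :: l).length + A.dim y * A.tupleDim (x :: l)) •
          (shuffle (x :: l) m).mapDomain (fun t => y :: t)
  termination_by l m => l.length + m.length

/-- The product of the cells `Δⁱ × X` and `Δʲ × Y`, where `X = x₁ × ⋯ × xᵢ` and `Y = y₁ × ⋯ × yⱼ`:
`Δⁱ × Δʲ` is subdivided by shuffles; the sign `(-1)^(j * dim X)` interchanges `X` and `Δʲ`. -/
def barMul (l m : List S) : List S →₀ ℤ :=
  (-1 : ℤ) ^ (m.length * A.tupleDim l) • A.shuffle l m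

/-- The bar construction: its cells are `Δⁿ × (x₁ × ⋯ × xₙ)`, indexed by `[x₁, …, xₙ]`. -/
def bar : CellData (List S) where
  dim l := l.length + A.tupleDim l
  bd := A.barBd
  mul := A.barMul

/-- The `n`-cells that satisfy `P` (the "nontrivial" ones). -/
abbrev NCell (P : S → Prop) (n : ℕ) : Type v := {x : S // P x ∧ A.dim x = n}

/-- Cellular `n`-cochains with values in the (multiplicative) abelian group `H`, on the quotient of
the cellular chain complex by the span of the cells that do not satisfy `P`. -/
abbrev Cochain (P : S → Prop) (H : Type u) (n : ℕ) : Type (max u v) := A.NCell P n → H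

open Classical in
/-- The value of an `n`-cochain on a cell, trivial on the cells that are divided out
and on cells of other dimensions. -/
def Cochain.onCell {A : CellData S} {P : S → Prop} {H : Type u} [CommGroup H] {n : ℕ}
    (f : A.Cochain P H n) (x : S) : H :=
  if h : P x ∧ A.dim x = n then f ⟨x, h⟩ else 1

/-- The coboundary `δf = f ∘ ∂`, written multiplicatively. -/
def coboundary (P : S → Prop) (H : Type u) [CommGroup H] (n : ℕ) :
    A.Cochain P H n →* A.Cochain P H (n + 1) where
  toFun f x := (A.bd x.1).prod fun y k => f.onCell y ^ k
  map_one' := by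
    funext x
    have h : ∀ y, Cochain.onCell (1 : A.Cochain P H n) y = 1 := by
      intro y
      unfold Cochain.onCell
      split_ifs <;> rfl
    simp [h, Finsupp.prod]
  map_mul' f g := by
    funext x
    have h : ∀ y, Cochain.onCell (f * g) y = f.onCell y * g.onCell y := by
      intro y
      unfold Cochain.onCell
      split_ifs <;> simp
    simp [h, mul_zpow, Finsupp.prod, Finset.prod_mul_distrib]

/-- Cellular `n`-cocycles. -/
def cocycles (P : S → Prop) (H : Type u) [CommGroup H] (n : ℕ) : Subgroup (A.Cochain P H n) :=
  (A.coboundary P H n).ker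

/-- Cellular `(n+1)`-coboundaries. -/
def coboundaries (P : S → Prop) (H : Type u) [CommGroup H] (n : ℕ) :
    Subgroup (A.Cochain P H (n + 1)) :=
  (A.coboundary P H n).range

end CellData

/-- A discrete group as a cell complex with multiplication. -/
def discrete (G : Type v) [Group G] : CellData G where
  dim _ := 0
  bd _ := 0
  mul a b := Finsupp.single (a * b) 1

/-- The bar construction `B_G`; its `n`-cells are the `n`-tuples of elements of `G`. -/
def B1 (G : Type v) [Group G] : CellData (List G) := (discrete G).bar

/-- The iterated bar construction `B²_G = B(B_G)` (for `G` abelian). -/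
def B2 (G : Type v) [Group G] : CellData (List (List G)) := (B1 G).bar

/-- The iterated bar construction `B³_G = B(B²_G)` (for `G` abelian). -/
def B3 (G : Type v) [Group G] : CellData (List (List (List G))) := (B2 G).bar

/-- No cell of `B_G` is divided out. -/
def Nontriv1 {G : Type v} (_ : List G) : Prop := True

/-- The cells of `B²_G` that do not involve the 0-cell of `B_G`. -/
def Nontriv2 {G : Type v} (L : List (List G)) : Prop := ∀ x ∈ L, x ≠ []

/-- The cells of `B³_G` that involve neither the 0-cell of `B²_G` nor the 0-cell of `B_G`. -/
def Nontriv3 {G : Type v} (L : List (List (List G))) : Prop := ∀ X ∈ L, X ≠ [] ∧ Nontriv2 X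

/-- The 2-cell `(a,b)` of `B_G`. -/
def cell1_2 {G : Type v} [Group G] (a b : G) : (B1 G).NCell Nontriv1 2 :=
  ⟨[a, b], trivial, rfl⟩

/-- The 3-cell `(a,b,c)` of `B_G`. -/
def cell1_3 {G : Type v} [Group G] (a b c : G) : (B1 G).NCell Nontriv1 3 :=
  ⟨[a, b, c], trivial, rfl⟩

/-- The 3-cell `Δ¹ × Δ²` of `B²_G` indexed by `(a,b)`. -/
def cell2_2 {G : Type v} [Group G] (a b : G) : (B2 G).NCell Nontriv2 3 :=
  ⟨[[a, b]], by simp [Nontriv2], rfl⟩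

/-- The 4-cell `Δ¹ × Δ³` of `B²_G` indexed by `(a,b,c)`. -/
def cell2_3 {G : Type v} [Group G] (a b c : G) : (B2 G).NCell Nontriv2 4 :=
  ⟨[[a, b, c]], by simp [Nontriv2], rfl⟩

/-- The 4-cell `Δ² × (Δ¹ × Δ¹)` of `B²_G` indexed by `((a),(b))`. -/
def cell2_11 {G : Type v} [Group G] (a b : G) : (B2 G).NCell Nontriv2 4 :=
  ⟨[[a], [b]], by simp [Nontriv2], rfl⟩

/-- The 5-cell of `B³_G` that is `Δ¹` times the 4-cell `(a,b,c)` of `B²_G`. -/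
def cell3_3 {G : Type v} [Group G] (a b c : G) : (B3 G).NCell Nontriv3 5 :=
  ⟨[[[a, b, c]]], by simp [Nontriv3, Nontriv2], rfl⟩

/-- The 5-cell of `B³_G` that is `Δ¹` times the 4-cell `((a),(b))` of `B²_G`. -/
def cell3_11 {G : Type v} [Group G] (a b : G) : (B3 G).NCell Nontriv3 5 :=
  ⟨[[[a], [b]]], by simp [Nontriv3, Nontriv2], rfl⟩

/-! ### The category `R[G]` and its standard product -/

/-- Objects of `R[G]`: `G`-graded free `R`-modules of finite total dimension. The module is the
internal direct sum of its homogeneous pieces, each of which is free. -/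
structure Obj (R : Type u) [CommRing R] (G : Type v) where
  carrier : Type u
  [addCommGroup : AddCommGroup carrier]
  [module : Module R carrier]
  piece : G → Submodule R carrier
  indep : iSupIndep piece
  span : ⨆ g, piece g = ⊤
  finite : Module.Finite R carrier
  free : ∀ g, Module.Free R (piece g)

attribute [instance] Obj.addCommGroup Obj.module Obj.finite Obj.free

variable {R : Type u} [CommRing R] {G : Type v}

/-- Morphisms of `R[G]`: `R`-linear maps that preserve the grading. -/
@[ext]
structure Hom (X Y : Obj R G) where
  toLin : X.carrier →ₗ[R] Y.carrier
  map_mem : ∀ g, ∀ x ∈ X.piece g, toLin x ∈ Y.piece g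

instance : Category (Obj R G) where
  Hom X Y := Hom X Y
  id X := ⟨LinearMap.id, fun _ _ hx => hx⟩
  comp f g := ⟨g.toLin ∘ₗ f.toLin, fun a x hx => g.map_mem a _ (f.map_mem a x hx)⟩

/-- The linear map underlying a morphism. -/
def lin {X Y : Obj R G} (f : X ⟶ Y) : X.carrier →ₗ[R] Y.carrier := Hom.toLin f

theorem hom_ext {X Y : Obj R G} {f g : X ⟶ Y} (h : lin f = lin g) : f = g := Hom.ext h

section Basis

variable {M : Type u} [AddCommGroup M] [Module R M] {ι : Type*}

theorem basis_indep (b : Module.Basis ι R M) (deg : ι → G) :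
    iSupIndep (fun g => Submodule.span R (b '' {i | deg i = g})) := by
  intro g
  have h : (⨆ j, ⨆ (_ : j ≠ g), Submodule.span R (b '' {i | deg i = j}))
      ≤ Submodule.span R (b '' {i | deg i ≠ g}) := by
    refine iSup₂_le fun j hj => Submodule.span_mono (Set.image_mono ?_)
    rintro i rfl
    exact hj
  refine Disjoint.mono_right h (b.linearIndependent.disjoint_span_image ?_)
  rw [Set.disjoint_left]
  intro i hi hi'
  exact hi' hi

theorem basis_span (b : Module.Basis ι R M) (deg : ι → G) :
    ⨆ g, Submodule.span R (b '' {i | deg i = g}) = ⊤ := by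
  rw [eq_top_iff, ← b.span_eq, Submodule.span_le]
  rintro _ ⟨i, rfl⟩
  exact Submodule.mem_iSup_of_mem (deg i) (Submodule.subset_span ⟨i, rfl, rfl⟩)

theorem basis_free (b : Module.Basis ι R M) (s : Set ι) :
    Module.Free R (Submodule.span R (b '' s)) := by
  have h : LinearIndependent R (fun i : s => b i) :=
    b.linearIndependent.comp _ Subtype.val_injective
  have e : b '' s = Set.range (fun i : s => b i) := by
    ext x; simp
  rw [e]
  exact Module.Free.of_basis (Module.Basis.span h)

end Basis

/-- An object of `R[G]` has a basis of homogeneous elements. -/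
theorem exists_homogeneous_basis (X : Obj R G) :
    ∃ (ι : Type (max u v)) (b : Module.Basis ι R X.carrier) (deg : ι → G),
      ∀ g, X.piece g = Submodule.span R (b '' {i | deg i = g}) := by
  classical
  have hi : DirectSum.IsInternal X.piece :=
    (DirectSum.isInternal_submodule_iff_iSupIndep_and_iSup_eq_top _).2 ⟨X.indep, X.span⟩
  let v := fun g => Module.Free.chooseBasis R (X.piece g)
  refine ⟨_, hi.collectedBasis v, Sigma.fst, fun g => le_antisymm ?_ ?_⟩
  · have h : (⊤ : Submodule R (X.piece g)) = Submodule.span R (Set.range (v g)) :=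
      (v g).span_eq.symm
    have h2 : X.piece g = Submodule.map (X.piece g).subtype ⊤ := by simp
    rw [h2, h, Submodule.map_span, Submodule.span_le]
    rintro _ ⟨_, ⟨i, rfl⟩, rfl⟩
    exact Submodule.subset_span ⟨⟨g, i⟩, rfl, by simp⟩
  · rw [Submodule.span_le]
    rintro _ ⟨⟨g', i⟩, rfl, rfl⟩
    exact hi.collectedBasis_mem v _

variable [Group G]

/-- The standard product of gradings: `(a ⊗ b)_f` is the (direct) sum of the `a_g ⊗ b_h`
over all `g h` with `g * h = f`. -/
def tensorPiece (X Y : Obj R G) (f : G) : Submodule R (X.carrier ⊗[R] Y.carrier) :=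
  Submodule.span R {t | ∃ g h, g * h = f ∧ ∃ x ∈ X.piece g, ∃ y ∈ Y.piece h, t = x ⊗ₜ[R] y}

theorem tmul_mem_tensorPiece {X Y : Obj R G} {g h : G} {x : X.carrier} {y : Y.carrier}
    (hx : x ∈ X.piece g) (hy : y ∈ Y.piece h) : x ⊗ₜ[R] y ∈ tensorPiece X Y (g * h) :=
  Submodule.subset_span ⟨g, h, rfl, x, hx, y, hy, rfl⟩

theorem exists_tensor_basis (X Y : Obj R G) :
    ∃ (ι : Type (max u v)) (b : Module.Basis ι R (X.carrier ⊗[R] Y.carrier)) (deg : ι → G),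
      ∀ f, tensorPiece X Y f = Submodule.span R (b '' {i | deg i = f}) := by
  obtain ⟨ι, b, d, hb⟩ := exists_homogeneous_basis X
  obtain ⟨κ, c, e, hc⟩ := exists_homogeneous_basis Y
  refine ⟨ι × κ, b.tensorProduct c, fun p => d p.1 * e p.2, fun f => le_antisymm ?_ ?_⟩
  · refine Submodule.span_le.2 ?_
    rintro _ ⟨g, h, rfl, x, hx, y, hy, rfl⟩
    rw [hb] at hx
    rw [hc] at hy
    have hxy := Submodule.apply_mem_map₂ (TensorProduct.mk R X.carrier Y.carrier) hx hy
    rw [Submodule.map₂_span_span] at hxy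
    refine Submodule.span_mono ?_ hxy
    rintro _ ⟨_, ⟨i, rfl, rfl⟩, _, ⟨j, rfl, rfl⟩, rfl⟩
    exact ⟨(i, j), rfl, by simp⟩
  · refine Submodule.span_le.2 ?_
    rintro _ ⟨⟨i, j⟩, rfl, rfl⟩
    refine Submodule.subset_span ⟨d i, e j, rfl, b i, ?_, c j, ?_, by simp⟩
    · rw [hb]; exact Submodule.subset_span ⟨i, rfl, rfl⟩
    · rw [hc]; exact Submodule.subset_span ⟨j, rfl, rfl⟩

/-- The standard product of objects of `R[G]`. -/
def tObj (X Y : Obj R G) : Obj R G where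
  carrier := X.carrier ⊗[R] Y.carrier
  piece := tensorPiece X Y
  indep := by
    obtain ⟨ι, b, d, h⟩ := exists_tensor_basis X Y
    rw [show tensorPiece X Y = _ from funext h]
    exact basis_indep b d
  span := by
    obtain ⟨ι, b, d, h⟩ := exists_tensor_basis X Y
    rw [show tensorPiece X Y = _ from funext h]
    exact basis_span b d
  finite := inferInstance
  free f := by
    obtain ⟨ι, b, d, h⟩ := exists_tensor_basis X Y
    rw [h]
    exact basis_free b _

/-- The homogeneous tensor `x ⊗ y` as an element of the product object. -/
def tmk {X Y : Obj R G} (x : X.carrier) (y : Y.carrier) : (tObj X Y).carrier := x ⊗ₜ[R] y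

/-- The standard product of morphisms of `R[G]`. -/
def tHom {X X' Y Y' : Obj R G} (f : X ⟶ X') (g : Y ⟶ Y') : tObj X Y ⟶ tObj X' Y' :=
  Hom.mk (X := tObj X Y) (Y := tObj X' Y') (TensorProduct.map (lin f) (lin g)) (by
    intro a
    change tensorPiece X Y a ≤ (tensorPiece X' Y' a).comap (TensorProduct.map (lin f) (lin g))
    refine Submodule.span_le.2 ?_
    rintro _ ⟨g', h', rfl, x, hx, y, hy, rfl⟩
    exact tmul_mem_tensorPiece (Hom.map_mem f _ _ hx) (Hom.map_mem g _ _ hy))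

theorem tHom_id (X Y : Obj R G) : tHom (𝟙 X) (𝟙 Y) = 𝟙 (tObj X Y) :=
  hom_ext TensorProduct.map_id

theorem tHom_comp {X X' X'' Y Y' Y'' : Obj R G} (f : X ⟶ X') (f' : X' ⟶ X'')
    (g : Y ⟶ Y') (g' : Y' ⟶ Y'') : tHom (f ≫ f') (g ≫ g') = tHom f g ≫ tHom f' g' :=
  hom_ext (TensorProduct.map_comp _ _ _ _)

/-- The simple object at `g`: a copy of `R` in degree `g` and zero in all other degrees. -/
def simple (R : Type u) [CommRing R] (g : G) : Obj R G where
  carrier := R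
  piece h := ⨆ (_ : h = g), ⊤
  indep := by
    intro h
    by_cases hh : h = g
    · subst hh
      refine disjoint_bot_right.mono_right (iSup₂_le fun j hj => ?_)
      simp [hj]
    · simp [hh]
  span := by
    rw [eq_top_iff]
    exact le_iSup_of_le g (by simp)
  finite := inferInstance
  free h := by
    by_cases hh : h = g
    · rw [iSup_pos hh]; exact Module.Free.of_equiv Submodule.topEquiv.symm
    · rw [iSup_neg hh]; infer_instance

/-! ### Associativity, commutativity and unit structures for the standard product -/

/-- A natural associativity isomorphism for the standard product on `R[G]`: a natural isomorphism
`(X ⊗ Y) ⊗ Z ≅ X ⊗ (Y ⊗ Z)` that satisfies the pentagon axiom. -/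
structure AssocStr (R : Type u) [CommRing R] (G : Type v) [Group G] where
  iso : ∀ X Y Z : Obj R G, tObj (tObj X Y) Z ≅ tObj X (tObj Y Z)
  natural : ∀ {X X' Y Y' Z Z' : Obj R G} (f : X ⟶ X') (g : Y ⟶ Y') (h : Z ⟶ Z'),
    tHom (tHom f g) h ≫ (iso X' Y' Z').hom = (iso X Y Z).hom ≫ tHom f (tHom g h)
  pentagon : ∀ W X Y Z : Obj R G,
    tHom (iso W X Y).hom (𝟙 Z) ≫ (iso W (tObj X Y) Z).hom ≫ tHom (𝟙 W) (iso X Y Z).hom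
      = (iso (tObj W X) Y Z).hom ≫ (iso W X (tObj Y Z)).hom

/-- A braided-commutative structure for the standard product on `R[G]`: natural associativity and
commutativity isomorphisms that satisfy the pentagon axiom and both hexagon axioms. -/
structure BraidedStr (R : Type u) [CommRing R] (G : Type v) [Group G] extends AssocStr R G where
  comm : ∀ X Y : Obj R G, tObj X Y ≅ tObj Y X
  comm_natural : ∀ {X X' Y Y' : Obj R G} (f : X ⟶ X') (g : Y ⟶ Y'),
    tHom f g ≫ (comm X' Y').hom = (comm X Y).hom ≫ tHom g f
  hexagon_forward : ∀ X Y Z : Obj R G,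
    (iso X Y Z).hom ≫ (comm X (tObj Y Z)).hom ≫ (iso Y Z X).hom
      = tHom (comm X Y).hom (𝟙 Z) ≫ (iso Y X Z).hom ≫ tHom (𝟙 Y) (comm X Z).hom
  hexagon_reverse : ∀ X Y Z : Obj R G,
    (iso X Y Z).inv ≫ (comm (tObj X Y) Z).hom ≫ (iso Z X Y).inv
      = tHom (𝟙 X) (comm Y Z).hom ≫ (iso X Z Y).inv ≫ tHom (comm X Z).hom (𝟙 Y)

/-- A symmetric structure for the standard product on `R[G]`. -/
structure SymmetricStr (R : Type u) [CommRing R] (G : Type v) [Group G] extends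
    BraidedStr R G where
  symmetry : ∀ X Y : Obj R G, (comm X Y).hom ≫ (comm Y X).hom = 𝟙 (tObj X Y)

/-- Unit isomorphisms for an associativity structure, with unit the simple object at `1`. -/
structure UnitStr (A : AssocStr R G) where
  left : ∀ X : Obj R G, tObj (simple R 1) X ≅ X
  right : ∀ X : Obj R G, tObj X (simple R 1) ≅ X
  left_natural : ∀ {X Y : Obj R G} (f : X ⟶ Y),
    tHom (𝟙 (simple R 1)) f ≫ (left Y).hom = (left X).hom ≫ f
  right_natural : ∀ {X Y : Obj R G} (f : X ⟶ Y),
    tHom f (𝟙 (simple R 1)) ≫ (right Y).hom = (right X).hom ≫ f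
  triangle : ∀ X Y : Obj R G,
    (A.iso X (simple R 1) Y).hom ≫ tHom (𝟙 X) (left Y).hom = tHom (right X).hom (𝟙 Y)

/-- An associativity structure with unit isomorphisms is a monoidal structure on `R[G]`. -/
@[reducible]
def UnitStr.monoidal {A : AssocStr R G} (U : UnitStr A) : MonoidalCategory (Obj R G) where
  tensorObj := tObj
  whiskerLeft X _ _ f := tHom (𝟙 X) f
  whiskerRight f Y := tHom f (𝟙 Y)
  tensorHom := tHom
  tensorUnit := simple R 1
  associator := A.iso
  leftUnitor := U.left
  rightUnitor := U.right
  tensorHom_def f g := by rw [← tHom_comp]; simp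
  id_tensorHom_id := tHom_id
  tensorHom_comp_tensorHom f₁ f₂ g₁ g₂ := (tHom_comp f₁ g₁ f₂ g₂).symm
  whiskerLeft_id := tHom_id
  id_whiskerRight := tHom_id
  associator_naturality := A.natural
  leftUnitor_naturality := U.left_natural
  rightUnitor_naturality := U.right_natural
  pentagon := A.pentagon
  triangle := U.triangle

/-- A braided-commutative structure with unit isomorphisms is a braided monoidal structure. -/
@[reducible]
def UnitStr.braided (B : BraidedStr R G) (U : UnitStr B.toAssocStr) :
    @BraidedCategory (Obj R G) _ U.monoidal :=
  letI := U.monoidal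
  { braiding := B.comm
    braiding_naturality_right := fun X _ _ f => B.comm_natural (𝟙 X) f
    braiding_naturality_left := fun f Z => B.comm_natural f (𝟙 Z)
    hexagon_forward := B.hexagon_forward
    hexagon_reverse := B.hexagon_reverse }

/-- A symmetric structure with unit isomorphisms is a symmetric monoidal structure. -/
@[reducible]
def UnitStr.symmetric (B : SymmetricStr R G) (U : UnitStr B.toAssocStr) :
    @SymmetricCategory (Obj R G) _ U.monoidal :=
  letI := U.monoidal
  letI := UnitStr.braided B.toBraidedStr U
  { symmetry := B.symmetry }

/-- A natural (invertible) transformation of the standard product functor to itself. -/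
structure ProductAut (R : Type u) [CommRing R] (G : Type v) [Group G] where
  iso : ∀ X Y : Obj R G, tObj X Y ≅ tObj X Y
  natural : ∀ {X X' Y Y' : Obj R G} (f : X ⟶ X') (g : Y ⟶ Y'),
    tHom f g ≫ (iso X' Y').hom = (iso X Y).hom ≫ tHom f g

/-- `A'` is obtained from `A` by composition with the self-transformation `T` of the product:
the identity functor together with `T` commutes with the associativity isomorphisms. -/
def ProductAut.CarriesAssoc (T : ProductAut R G) (A A' : AssocStr R G) : Prop :=
  ∀ X Y Z : Obj R G,
    (A.iso X Y Z).hom ≫ tHom (𝟙 X) (T.iso Y Z).hom ≫ (T.iso X (tObj Y Z)).hom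
      = tHom (T.iso X Y).hom (𝟙 Z) ≫ (T.iso (tObj X Y) Z).hom ≫ (A'.iso X Y Z).hom

/-- The identity functor together with `T` commutes with the associativity and the commutativity
isomorphisms of `B` and `B'`. -/
def ProductAut.CarriesBraided (T : ProductAut R G) (B B' : BraidedStr R G) : Prop :=
  T.CarriesAssoc B.toAssocStr B'.toAssocStr ∧
    ∀ X Y : Obj R G,
      (B.comm X Y).hom ≫ (T.iso Y X).hom = (T.iso X Y).hom ≫ (B'.comm X Y).hom

/-- The associativity isomorphism of `A` is the standard one multiplied by `α(a,b,c)` in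
degrees `a, b, c`. -/
def AssocStr.HasScalars (A : AssocStr R G) (α : G → G → G → Rˣ) : Prop :=
  ∀ (X Y Z : Obj R G) (a b c : G), ∀ x ∈ X.piece a, ∀ y ∈ Y.piece b, ∀ z ∈ Z.piece c,
    lin (A.iso X Y Z).hom (tmk (tmk x y) z) = (α a b c : R) • tmk x (tmk y z)

/-- The commutativity isomorphism of `B` is the standard one multiplied by `τ(a,b)` in
degrees `a, b`. -/
def BraidedStr.CommHasScalars (B : BraidedStr R G) (τ : G → G → Rˣ) : Prop :=
  ∀ (X Y : Obj R G) (a b : G), ∀ x ∈ X.piece a, ∀ y ∈ Y.piece b,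
    lin (B.comm X Y).hom (tmk x y) = (τ a b : R) • tmk y x

/-- The self-transformation `T` of the product is multiplication by `μ(a,b)` in degrees `a, b`. -/
def ProductAut.HasScalars (T : ProductAut R G) (μ : G → G → Rˣ) : Prop :=
  ∀ (X Y : Obj R G) (a b : G), ∀ x ∈ X.piece a, ∀ y ∈ Y.piece b,
    lin (T.iso X Y).hom (tmk x y) = (μ a b : R) • tmk x y

end

end GroupCat

namespace GroupCat

/-! ### Linear algebra of graded modules and simple objects -/

section GradedLinear

variable {R : Type u} [CommRing R] {G : Type v}

/-! Everything is decided on the simple objects. A homogeneous element of degree a is the image of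
the generator under a morphism from the simple object at a, so naturality determines a structure
isomorphism by its values on products of simple objects. Such products are free of rank one, so
these values are units of R (`AssocStr.exists_scalars`, `ProductAut.exists_scalars`,
`BraidedStr.exists_commScalars`). Conversely, objects have homogeneous bases, so any family of units
defines a natural isomorphism. Comparing two composites on homogeneous pure tensors turns each axiom
into an identity between units: `PentagonScalars`, `HexagonForward`, `HexagonReverse`, and
τ(a,b)τ(b,a) = 1 for symmetry.

The same identities are the cocycle conditions, because dimension counts leave few cells. The cells
(a,b,c,d) of B_G and Δ¹ × (a,b,c,d) of B²_G give the pentagon. The other 5-cells of B²_G are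
((a),(b,c)) and ((a,b),(c)). In their boundaries the shuffle product contributes three values of α,
and the boundary of the two-dimensional factor three values of σ; with τ = σ⁻¹ these are the two
hexagons (`B2_bd_one_two`, `B2_bd_two_one`). B³_G suspends these cells and adds the family
((a)),((b)), whose boundary is a sum of two cells with equal signs (`B3_bd_one_one`): this is
symmetry.

Likewise, compatibility of the identity functor with an automorphism of the product is an identity
between units, and it is the coboundary relation. The factor Δ¹ reverses the sign of the boundary,
hence μ⁻¹ in place of μ on B²_G. Unit isomorphisms come from the scalars α(1,1,a)⁻¹ and α(a,1,1);
the triangle axiom is then the pentagon at (a,1,1,b). -/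

theorem Obj.span_homogeneous (X : Obj R G) :
    Submodule.span R {x | ∃ a, x ∈ X.piece a} = ⊤ := by
  rw [eq_top_iff, ← X.span]
  exact iSup_le fun a x hx => Submodule.subset_span ⟨a, hx⟩

/-- A linear map may be prescribed on a homogeneous basis, and the piece of degree a is spanned by
the basis vectors of degree a. This is the source of all maps that multiply by degree-dependent
units. -/
theorem Obj.exists_glue (X : Obj R G) {M : Type*} [AddCommGroup M] [Module R M]
    (c : G → X.carrier →ₗ[R] M) :
    ∃ L : X.carrier →ₗ[R] M, ∀ a, ∀ x ∈ X.piece a, L x = c a x := by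
  obtain ⟨ι, b, deg, h⟩ := exists_homogeneous_basis X
  refine ⟨b.constr R fun i => c (deg i) (b i), fun a x hx => ?_⟩
  rw [h] at hx
  refine LinearMap.eqOn_span (f := b.constr R fun i => c (deg i) (b i)) (g := c a) ?_ hx
  rintro _ ⟨i, rfl, rfl⟩
  exact b.constr_basis R _ i

/-- The linear map out of a graded module that is `c a` on the piece of degree `a`. -/
noncomputable def Obj.glue (X : Obj R G) {M : Type*} [AddCommGroup M] [Module R M]
    (c : G → X.carrier →ₗ[R] M) : X.carrier →ₗ[R] M := (X.exists_glue c).choose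

theorem Obj.glue_apply (X : Obj R G) {M : Type*} [AddCommGroup M] [Module R M]
    (c : G → X.carrier →ₗ[R] M) {a : G} {x : X.carrier} (hx : x ∈ X.piece a) :
    X.glue c x = c a x := (X.exists_glue c).choose_spec a x hx

@[simp] theorem lin_comp {X Y Z : Obj R G} (f : X ⟶ Y) (g : Y ⟶ Z) (x : X.carrier) :
    lin (f ≫ g) x = lin g (lin f x) := rfl

@[simp] theorem lin_id (X : Obj R G) (x : X.carrier) : lin (𝟙 X) x = x := rfl

theorem lin_mem {X Y : Obj R G} (f : X ⟶ Y) {a : G} {x : X.carrier} (hx : x ∈ X.piece a) :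
    lin f x ∈ Y.piece a := Hom.map_mem f a x hx

theorem lin_inv_of_lin_hom {X Y : Obj R G} (e : X ≅ Y) {x : X.carrier} {y : Y.carrier} {r : Rˣ}
    (h : lin e.hom x = (r : R) • y) : lin e.inv y = ((r⁻¹ : Rˣ) : R) • x := by
  have h1 : lin e.inv (lin e.hom x) = x := by rw [← lin_comp, e.hom_inv_id, lin_id]
  rw [h, map_smul] at h1
  rw [← h1, smul_smul, Units.inv_mul, one_smul]

/-- An isomorphism of graded modules from mutually inverse grading-preserving maps. -/
def isoOfLin {X Y : Obj R G} (f : X.carrier →ₗ[R] Y.carrier)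
    (g : Y.carrier →ₗ[R] X.carrier) (hf : ∀ a, ∀ x ∈ X.piece a, f x ∈ Y.piece a)
    (hg : ∀ a, ∀ y ∈ Y.piece a, g y ∈ X.piece a) (hfg : g ∘ₗ f = LinearMap.id)
    (hgf : f ∘ₗ g = LinearMap.id) : X ≅ Y where
  hom := Hom.mk f hf
  inv := Hom.mk g hg
  hom_inv_id := hom_ext hfg
  inv_hom_id := hom_ext hgf

variable [Group G]

/-- The generator of a simple object. -/
def gen (R : Type u) [CommRing R] (g : G) : (simple R g).carrier := (1 : R)

theorem gen_mem (g : G) : gen R g ∈ (simple R g).piece g := by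
  have h : (1 : R) ∈ (⨆ (_ : g = g), ⊤ : Submodule R R) := by
    rw [iSup_pos rfl]; exact Submodule.mem_top
  exact h

/-- The morphism from a simple object that corresponds to a homogeneous element. -/
def ofElement {X : Obj R G} {a : G} (x : X.carrier) (hx : x ∈ X.piece a) : simple R a ⟶ X :=
  Hom.mk (X := simple R a) (LinearMap.toSpanSingleton R X.carrier x) (by
    intro g
    change (⨆ (_ : g = a), ⊤ : Submodule R R) ≤
      (X.piece g).comap (LinearMap.toSpanSingleton R X.carrier x)
    refine iSup_le fun h r _ => ?_
    subst h
    exact (X.piece g).smul_mem _ hx)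

@[simp] theorem lin_ofElement {X : Obj R G} {a : G} (x : X.carrier) (hx : x ∈ X.piece a) :
    lin (ofElement x hx) (gen R a) = x := one_smul R x

@[simp] theorem lin_tHom {X X' Y Y' : Obj R G} (f : X ⟶ X') (g : Y ⟶ Y') (x : X.carrier)
    (y : Y.carrier) : lin (tHom f g) (tmk x y) = tmk (lin f x) (lin g y) := rfl

@[simp] theorem tmk_smul_left {X Y : Obj R G} (r : R) (x : X.carrier) (y : Y.carrier) :
    (tmk (r • x) y : (tObj X Y).carrier) = r • tmk x y := TensorProduct.smul_tmul' r x y |>.symm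

@[simp] theorem tmk_smul_right {X Y : Obj R G} (r : R) (x : X.carrier) (y : Y.carrier) :
    (tmk x (r • y) : (tObj X Y).carrier) = r • tmk x y := TensorProduct.tmul_smul r x y

theorem tmk_mem {X Y : Obj R G} {g h : G} {x : X.carrier} {y : Y.carrier}
    (hx : x ∈ X.piece g) (hy : y ∈ Y.piece h) : tmk x y ∈ (tObj X Y).piece (g * h) :=
  tmul_mem_tensorPiece hx hy

/-! ### Reduction to homogeneous pure tensors -/

section Ext

variable {M : Type*} [AddCommGroup M] [Module R M] {W X Y Z : Obj R G}

/-- `tmk` as a bilinear map. -/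
def tmkₗ (X Y : Obj R G) : X.carrier →ₗ[R] Y.carrier →ₗ[R] (tObj X Y).carrier :=
  TensorProduct.mk R X.carrier Y.carrier

@[simp] theorem tmkₗ_apply (x : X.carrier) (y : Y.carrier) : tmkₗ X Y x y = tmk x y := rfl

/-- The linear map out of a product that is given by a bilinear map. -/
noncomputable def tlift (f : X.carrier →ₗ[R] Y.carrier →ₗ[R] M) : (tObj X Y).carrier →ₗ[R] M :=
  TensorProduct.lift f

@[simp] theorem tlift_tmk (f : X.carrier →ₗ[R] Y.carrier →ₗ[R] M) (x : X.carrier)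
    (y : Y.carrier) : tlift f (tmk x y) = f x y := TensorProduct.lift.tmul x y

/-- The span of the products of two sets is the image of the two spans under the bilinear map. Since
the conclusion has the shape of the hypotheses, the lemma iterates over nested products. -/
theorem span_tmk {S : Set X.carrier} {T : Set Y.carrier} (hS : Submodule.span R S = ⊤)
    (hT : Submodule.span R T = ⊤) :
    Submodule.span R {t : (tObj X Y).carrier | ∃ x ∈ S, ∃ y ∈ T, tmk x y = t} = ⊤ := by
  have h := Submodule.map₂_span_span R (TensorProduct.mk R X.carrier Y.carrier) S T
  rw [hS, hT, TensorProduct.map₂_mk_top_top_eq_top] at h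
  exact h.symm

theorem ext_tmk₂ {f g : (tObj X Y).carrier →ₗ[R] M}
    (h : ∀ a b, ∀ x ∈ X.piece a, ∀ y ∈ Y.piece b, f (tmk x y) = g (tmk x y)) : f = g := by
  refine LinearMap.ext_on (span_tmk X.span_homogeneous Y.span_homogeneous) ?_
  rintro _ ⟨x, ⟨a, hx⟩, y, ⟨b, hy⟩, rfl⟩
  exact h a b x hx y hy

theorem ext_tmk₃ {f g : (tObj (tObj X Y) Z).carrier →ₗ[R] M}
    (h : ∀ a b c, ∀ x ∈ X.piece a, ∀ y ∈ Y.piece b, ∀ z ∈ Z.piece c,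
      f (tmk (tmk x y) z) = g (tmk (tmk x y) z)) : f = g := by
  refine LinearMap.ext_on (span_tmk (span_tmk X.span_homogeneous Y.span_homogeneous)
    Z.span_homogeneous) ?_
  rintro _ ⟨_, ⟨x, ⟨a, hx⟩, y, ⟨b, hy⟩, rfl⟩, z, ⟨c, hz⟩, rfl⟩
  exact h a b c x hx y hy z hz

/-- The other bracketing is needed for the second hexagon, whose composites start at X ⊗ (Y ⊗ Z). -/
theorem ext_tmk₃' {f g : (tObj X (tObj Y Z)).carrier →ₗ[R] M}
    (h : ∀ a b c, ∀ x ∈ X.piece a, ∀ y ∈ Y.piece b, ∀ z ∈ Z.piece c,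
      f (tmk x (tmk y z)) = g (tmk x (tmk y z))) : f = g := by
  refine LinearMap.ext_on (span_tmk X.span_homogeneous (span_tmk Y.span_homogeneous
    Z.span_homogeneous)) ?_
  rintro _ ⟨x, ⟨a, hx⟩, _, ⟨y, ⟨b, hy⟩, z, ⟨c, hz⟩, rfl⟩, rfl⟩
  exact h a b c x hx y hy z hz

theorem ext_tmk₄ {f g : (tObj (tObj (tObj W X) Y) Z).carrier →ₗ[R] M}
    (h : ∀ a b c d, ∀ w ∈ W.piece a, ∀ x ∈ X.piece b, ∀ y ∈ Y.piece c, ∀ z ∈ Z.piece d,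
      f (tmk (tmk (tmk w x) y) z) = g (tmk (tmk (tmk w x) y) z)) : f = g := by
  refine LinearMap.ext_on (span_tmk (span_tmk (span_tmk W.span_homogeneous X.span_homogeneous)
    Y.span_homogeneous) Z.span_homogeneous) ?_
  rintro _ ⟨_, ⟨_, ⟨w, ⟨a, hw⟩, x, ⟨b, hx⟩, rfl⟩, y, ⟨c, hy⟩, rfl⟩, z, ⟨d, hz⟩, rfl⟩
  exact h a b c d w hw x hx y hy z hz

theorem map_mem_of_tmk {N : Submodule R M} (f : (tObj X Y).carrier →ₗ[R] M) {g : G}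
    (h : ∀ a b, a * b = g → ∀ x ∈ X.piece a, ∀ y ∈ Y.piece b, f (tmk x y) ∈ N) :
    ∀ t ∈ (tObj X Y).piece g, f t ∈ N := by
  change tensorPiece X Y g ≤ N.comap f
  refine Submodule.span_le.2 ?_
  rintro _ ⟨a, b, hab, x, hx, y, hy, rfl⟩
  exact h a b hab x hx y hy

theorem map_mem_of_tmk₃ {N : Submodule R M} (f : (tObj (tObj X Y) Z).carrier →ₗ[R] M) {g : G}
    (h : ∀ a b c, a * b * c = g → ∀ x ∈ X.piece a, ∀ y ∈ Y.piece b, ∀ z ∈ Z.piece c,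
      f (tmk (tmk x y) z) ∈ N) :
    ∀ t ∈ (tObj (tObj X Y) Z).piece g, f t ∈ N := by
  refine map_mem_of_tmk f ?_
  rintro d c rfl t ht z hz
  -- With z fixed, the map t ↦ f (t ⊗ z) is linear on X ⊗ Y, so the twofold case applies again.
  refine map_mem_of_tmk (f ∘ₗ (tmkₗ (tObj X Y) Z).flip z) ?_ t ht
  rintro a b rfl x hx y hy
  exact h a b c rfl x hx y hy z hz

theorem map_mem_of_tmk₃' {N : Submodule R M} (f : (tObj X (tObj Y Z)).carrier →ₗ[R] M) {g : G}
    (h : ∀ a b c, a * (b * c) = g → ∀ x ∈ X.piece a, ∀ y ∈ Y.piece b, ∀ z ∈ Z.piece c,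
      f (tmk x (tmk y z)) ∈ N) :
    ∀ t ∈ (tObj X (tObj Y Z)).piece g, f t ∈ N := by
  refine map_mem_of_tmk f ?_
  rintro a d rfl x hx t ht
  refine map_mem_of_tmk (f ∘ₗ tmkₗ X (tObj Y Z) x) ?_ t ht
  rintro b c rfl y hy z hz
  exact h a b c rfl x hx y hy z hz

end Ext

/-! ### Isomorphisms that multiply by units -/

section Scale

/-- The endomorphism of `X ⊗ Y` that is `e b` on the left factor in degree `b` of the right
factor. -/
noncomputable def glueRight (X Y : Obj R G) (e : G → X.carrier →ₗ[R] X.carrier) :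
    (tObj X Y).carrier →ₗ[R] (tObj X Y).carrier :=
  -- Gluing runs over the degree of the right factor, so the bilinear map is flipped to take y first
  -- and then flipped back.
  tlift (Y.glue fun b => (tmkₗ X Y ∘ₗ e b).flip).flip

theorem glueRight_tmk {X Y : Obj R G} (e : G → X.carrier →ₗ[R] X.carrier) (x : X.carrier) {b : G}
    {y : Y.carrier} (hy : y ∈ Y.piece b) : glueRight X Y e (tmk x y) = tmk (e b x) y := by
  simp [glueRight, Y.glue_apply _ hy]

/-- Multiplication by `c a` in degree `a`. -/
noncomputable def scale₁ (X : Obj R G) (c : G → Rˣ) : X.carrier →ₗ[R] X.carrier :=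
  X.glue fun a => (c a : R) • LinearMap.id

theorem scale₁_apply {X : Obj R G} (c : G → Rˣ) {a : G} {x : X.carrier} (hx : x ∈ X.piece a) :
    scale₁ X c x = (c a : R) • x := by
  simp [scale₁, X.glue_apply _ hx]

/-- Multiplication by `μ a b` in degrees `a`, `b`. -/
noncomputable def scale₂ (X Y : Obj R G) (μ : G → G → Rˣ) :
    (tObj X Y).carrier →ₗ[R] (tObj X Y).carrier :=
  glueRight X Y fun b => scale₁ X fun a => μ a b

theorem scale₂_tmk {X Y : Obj R G} (μ : G → G → Rˣ) {a b : G} {x : X.carrier} {y : Y.carrier}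
    (hx : x ∈ X.piece a) (hy : y ∈ Y.piece b) :
    scale₂ X Y μ (tmk x y) = (μ a b : R) • tmk x y := by
  rw [scale₂, glueRight_tmk _ _ hy, scale₁_apply _ hx, tmk_smul_left]

/-- Multiplication by `α a b c` in degrees `a`, `b`, `c`. -/
noncomputable def scale₃ (X Y Z : Obj R G) (α : G → G → G → Rˣ) :
    (tObj (tObj X Y) Z).carrier →ₗ[R] (tObj (tObj X Y) Z).carrier :=
  glueRight (tObj X Y) Z fun c => scale₂ X Y fun a b => α a b c

theorem scale₃_tmk {X Y Z : Obj R G} (α : G → G → G → Rˣ) {a b c : G} {x : X.carrier}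
    {y : Y.carrier} {z : Z.carrier} (hx : x ∈ X.piece a) (hy : y ∈ Y.piece b)
    (hz : z ∈ Z.piece c) :
    scale₃ X Y Z α (tmk (tmk x y) z) = (α a b c : R) • tmk (tmk x y) z := by
  rw [scale₃, glueRight_tmk _ _ hz, scale₂_tmk _ hx hy, tmk_smul_left]

/-- Multiplication by units, as an automorphism of an object. -/
noncomputable def scaleIso₁ (X : Obj R G) (c : G → Rˣ) : X ≅ X :=
  isoOfLin (scale₁ X c) (scale₁ X c⁻¹)
    (fun a x hx => by rw [scale₁_apply c hx]; exact Submodule.smul_mem _ _ hx)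
    (fun a x hx => by rw [scale₁_apply _ hx]; exact Submodule.smul_mem _ _ hx)
    (LinearMap.ext_on X.span_homogeneous (by
      rintro x ⟨a, hx⟩
      simp [scale₁_apply _ hx, smul_smul]))
    (LinearMap.ext_on X.span_homogeneous (by
      rintro x ⟨a, hx⟩
      simp [scale₁_apply _ hx, smul_smul]))

theorem scaleIso₁_apply {X : Obj R G} (c : G → Rˣ) {a : G} {x : X.carrier} (hx : x ∈ X.piece a) :
    lin (scaleIso₁ X c).hom x = (c a : R) • x := scale₁_apply c hx

/-- Multiplication by units, as an automorphism of a product. -/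
noncomputable def scaleIso₂ (X Y : Obj R G) (μ : G → G → Rˣ) : tObj X Y ≅ tObj X Y :=
  isoOfLin (scale₂ X Y μ) (scale₂ X Y μ⁻¹)
    (fun g => map_mem_of_tmk _ (by
      rintro a b rfl x hx y hy
      rw [scale₂_tmk _ hx hy]
      exact Submodule.smul_mem _ _ (tmk_mem hx hy)))
    (fun g => map_mem_of_tmk _ (by
      rintro a b rfl x hx y hy
      rw [scale₂_tmk _ hx hy]
      exact Submodule.smul_mem _ _ (tmk_mem hx hy)))
    (ext_tmk₂ fun a b x hx y hy => by simp [scale₂_tmk _ hx hy, smul_smul])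
    (ext_tmk₂ fun a b x hx y hy => by simp [scale₂_tmk _ hx hy, smul_smul])

theorem scaleIso₂_tmk {X Y : Obj R G} (μ : G → G → Rˣ) {a b : G} {x : X.carrier} {y : Y.carrier}
    (hx : x ∈ X.piece a) (hy : y ∈ Y.piece b) :
    lin (scaleIso₂ X Y μ).hom (tmk x y) = (μ a b : R) • tmk x y := scale₂_tmk μ hx hy

/-- Multiplication by units, as an automorphism of a threefold product. -/
noncomputable def scaleIso₃ (X Y Z : Obj R G) (α : G → G → G → Rˣ) :
    tObj (tObj X Y) Z ≅ tObj (tObj X Y) Z :=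
  isoOfLin (scale₃ X Y Z α) (scale₃ X Y Z α⁻¹)
    (fun g => map_mem_of_tmk₃ _ (by
      rintro a b c rfl x hx y hy z hz
      rw [scale₃_tmk _ hx hy hz]
      exact Submodule.smul_mem _ _ (tmk_mem (tmk_mem hx hy) hz)))
    (fun g => map_mem_of_tmk₃ _ (by
      rintro a b c rfl x hx y hy z hz
      rw [scale₃_tmk _ hx hy hz]
      exact Submodule.smul_mem _ _ (tmk_mem (tmk_mem hx hy) hz)))
    (ext_tmk₃ fun a b c x hx y hy z hz => by simp [scale₃_tmk _ hx hy hz, smul_smul])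
    (ext_tmk₃ fun a b c x hx y hy z hz => by simp [scale₃_tmk _ hx hy hz, smul_smul])

theorem scaleIso₃_tmk {X Y Z : Obj R G} (α : G → G → G → Rˣ) {a b c : G} {x : X.carrier}
    {y : Y.carrier} {z : Z.carrier} (hx : x ∈ X.piece a) (hy : y ∈ Y.piece b)
    (hz : z ∈ Z.piece c) :
    lin (scaleIso₃ X Y Z α).hom (tmk (tmk x y) z) = (α a b c : R) • tmk (tmk x y) z :=
  scale₃_tmk α hx hy hz

/-- The standard associativity isomorphism of modules. -/
noncomputable def assocLin (X Y Z : Obj R G) :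
    (tObj (tObj X Y) Z).carrier ≃ₗ[R] (tObj X (tObj Y Z)).carrier :=
  TensorProduct.assoc R X.carrier Y.carrier Z.carrier

/-- The standard associativity isomorphism. -/
noncomputable def stdAssoc (X Y Z : Obj R G) : tObj (tObj X Y) Z ≅ tObj X (tObj Y Z) :=
  isoOfLin (assocLin X Y Z).toLinearMap (assocLin X Y Z).symm.toLinearMap
    (fun g => map_mem_of_tmk₃ _ (by
      rintro a b c rfl x hx y hy z hz
      rw [mul_assoc]
      exact tmk_mem hx (tmk_mem hy hz)))
    (fun g => map_mem_of_tmk₃' _ (by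
      rintro a b c rfl x hx y hy z hz
      rw [← mul_assoc]
      exact tmk_mem (tmk_mem hx hy) hz))
    (LinearMap.ext fun t => (assocLin X Y Z).symm_apply_apply t)
    (LinearMap.ext fun t => (assocLin X Y Z).apply_symm_apply t)

@[simp] theorem stdAssoc_tmk {X Y Z : Obj R G} (x : X.carrier) (y : Y.carrier) (z : Z.carrier) :
    lin (stdAssoc X Y Z).hom (tmk (tmk x y) z) = tmk x (tmk y z) := rfl

/-- The standard commutativity isomorphism of modules. -/
noncomputable def commLin (X Y : Obj R G) : (tObj X Y).carrier ≃ₗ[R] (tObj Y X).carrier :=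
  TensorProduct.comm R X.carrier Y.carrier

/-- The standard commutativity isomorphism. -/
noncomputable def stdComm (hG : ∀ a b : G, a * b = b * a) (X Y : Obj R G) :
    tObj X Y ≅ tObj Y X :=
  isoOfLin (commLin X Y).toLinearMap (commLin X Y).symm.toLinearMap
    (fun g => map_mem_of_tmk _ (by
      rintro a b rfl x hx y hy
      -- The swap sends degree ab to degree ba; it preserves the grading because these agree.
      rw [hG]
      exact tmk_mem hy hx))
    (fun g => map_mem_of_tmk _ (by
      rintro a b rfl x hx y hy
      rw [hG]
      exact tmk_mem hy hx))
    (LinearMap.ext fun t => (commLin X Y).symm_apply_apply t)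
    (LinearMap.ext fun t => (commLin X Y).apply_symm_apply t)

@[simp] theorem stdComm_tmk (hG : ∀ a b : G, a * b = b * a) {X Y : Obj R G} (x : X.carrier)
    (y : Y.carrier) : lin (stdComm hG X Y).hom (tmk x y) = tmk y x := rfl

end Scale

end GradedLinear

/-! ### Scalars of natural isomorphisms on simple objects -/

section Structures

variable {R : Type u} [CommRing R] {G : Type v} [Group G]

/-- `x` generates a free module of rank one. -/
def IsGenerator {X : Obj R G} (x : X.carrier) : Prop := ∃ φ : X.carrier ≃ₗ[R] R, φ x = 1

theorem isGenerator_gen (g : G) : IsGenerator (gen R g) := ⟨LinearEquiv.refl R R, rfl⟩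

theorem IsGenerator.tmk {X Y : Obj R G} {x : X.carrier} {y : Y.carrier} (hx : IsGenerator x)
    (hy : IsGenerator y) : IsGenerator (tmk x y) := by
  obtain ⟨φ, hφ⟩ := hx
  obtain ⟨ψ, hψ⟩ := hy
  refine ⟨TensorProduct.congr φ ψ ≪≫ₗ TensorProduct.lid R R, ?_⟩
  change φ x • ψ y = 1
  rw [hφ, hψ, smul_eq_mul, one_mul]

/-- Coefficients of a generator can be compared. This extracts identities in R from equalities of
morphisms between products of simple objects. -/
theorem IsGenerator.smul_inj {X : Obj R G} {x : X.carrier} (hx : IsGenerator x) {r s : R}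
    (h : r • x = s • x) : r = s := by
  obtain ⟨φ, hφ⟩ := hx
  simpa [hφ] using congrArg φ h

/-- In terms of generators the isomorphism and its inverse are multiplication by elements r and s;
composing them gives r s = 1. -/
theorem IsGenerator.exists_unit {X Y : Obj R G} {x : X.carrier} {y : Y.carrier}
    (hx : IsGenerator x) (hy : IsGenerator y) (e : X ≅ Y) :
    ∃ u : Rˣ, lin e.hom x = (u : R) • y := by
  have hmul : ∀ {Z : Obj R G} {z : Z.carrier}, IsGenerator z → ∀ t, ∃ r : R, t = r • z := by
    rintro Z z ⟨φ, hφ⟩ t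
    refine ⟨φ t, φ.injective ?_⟩
    simp [hφ]
  obtain ⟨r, hr⟩ := hmul hy (lin e.hom x)
  obtain ⟨s, hs⟩ := hmul hx (lin e.inv y)
  have h1 : r * s = 1 := hx.smul_inj (by
    have h : lin e.inv (lin e.hom x) = x := by rw [← lin_comp, e.hom_inv_id, lin_id]
    rwa [hr, map_smul, hs, smul_smul, ← one_smul R x, smul_smul, mul_one] at h)
  exact ⟨⟨r, s, h1, by rw [mul_comm, h1]⟩, hr⟩

/-! ### Associativity structures -/

/-- The scalars are read off on simple objects. Naturality along the morphisms that send the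
generators to x, y, z transports them to arbitrary homogeneous elements. -/
theorem AssocStr.exists_scalars (A : AssocStr R G) : ∃ α, A.HasScalars α := by
  have h := fun a b c => IsGenerator.exists_unit
    (((isGenerator_gen (R := R) a).tmk (isGenerator_gen b)).tmk (isGenerator_gen c))
    ((isGenerator_gen a).tmk ((isGenerator_gen b).tmk (isGenerator_gen c)))
    (A.iso (simple R a) (simple R b) (simple R c))
  choose α hα using h
  refine ⟨α, fun X Y Z a b c x hx y hy z hz => ?_⟩
  have h1 := congrArg (fun f => lin f (tmk (tmk (gen R a) (gen R b)) (gen R c)))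
    (A.natural (ofElement x hx) (ofElement y hy) (ofElement z hz))
  simpa [hα] using h1

theorem AssocStr.scalars_unique {A : AssocStr R G} {α β : G → G → G → Rˣ} (hα : A.HasScalars α)
    (hβ : A.HasScalars β) : α = β := by
  funext a b c
  refine Units.ext (((isGenerator_gen (R := R) a).tmk ((isGenerator_gen b).tmk
    (isGenerator_gen c))).smul_inj ?_)
  rw [← hα _ _ _ a b c _ (gen_mem a) _ (gen_mem b) _ (gen_mem c),
    ← hβ _ _ _ a b c _ (gen_mem a) _ (gen_mem b) _ (gen_mem c)]

theorem AssocStr.ext_scalars {A A' : AssocStr R G} {α : G → G → G → Rˣ} (h : A.HasScalars α)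
    (h' : A'.HasScalars α) : A = A' := by
  have e : A.iso = A'.iso := by
    funext X Y Z
    refine Iso.ext (hom_ext (ext_tmk₃ fun a b c x hx y hy z hz => ?_))
    rw [h X Y Z a b c x hx y hy z hz, h' X Y Z a b c x hx y hy z hz]
  cases A
  cases A'
  cases e
  rfl

/-- The identity between scalars that is equivalent to the pentagon axiom. -/
def PentagonScalars {H : Type*} [CommGroup H] (α : G → G → G → H) : Prop :=
  ∀ a b c d, α a b c * α a (b * c) d * α b c d = α (a * b) c d * α a b (c * d)

section AssocIso

variable {iso : ∀ X Y Z : Obj R G, tObj (tObj X Y) Z ≅ tObj X (tObj Y Z)}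
  {α : G → G → G → Rˣ}

/-- Formulated for a bare family of isomorphisms, because it is needed both for a given structure
and for verifying the pentagon while a structure is being built. -/
theorem pentagon_left
    (h : ∀ (X Y Z : Obj R G) (a b c : G), ∀ x ∈ X.piece a, ∀ y ∈ Y.piece b, ∀ z ∈ Z.piece c,
      lin (iso X Y Z).hom (tmk (tmk x y) z) = (α a b c : R) • tmk x (tmk y z))
    {W X Y Z : Obj R G} {a b c d : G} {w : W.carrier} {x : X.carrier} {y : Y.carrier}
    {z : Z.carrier} (hw : w ∈ W.piece a) (hx : x ∈ X.piece b) (hy : y ∈ Y.piece c)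
    (hz : z ∈ Z.piece d) :
    lin (tHom (iso W X Y).hom (𝟙 Z) ≫ (iso W (tObj X Y) Z).hom ≫ tHom (𝟙 W) (iso X Y Z).hom)
      (tmk (tmk (tmk w x) y) z)
      = ((α a b c * α a (b * c) d * α b c d : Rˣ) : R) • tmk w (tmk x (tmk y z)) := by
  simp [h _ _ _ _ _ _ _ hw _ hx _ hy, h _ _ _ _ _ _ _ hw _ (tmk_mem hx hy) _ hz,
    h _ _ _ _ _ _ _ hx _ hy _ hz, smul_smul, mul_assoc]

theorem pentagon_right
    (h : ∀ (X Y Z : Obj R G) (a b c : G), ∀ x ∈ X.piece a, ∀ y ∈ Y.piece b, ∀ z ∈ Z.piece c,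
      lin (iso X Y Z).hom (tmk (tmk x y) z) = (α a b c : R) • tmk x (tmk y z))
    {W X Y Z : Obj R G} {a b c d : G} {w : W.carrier} {x : X.carrier} {y : Y.carrier}
    {z : Z.carrier} (hw : w ∈ W.piece a) (hx : x ∈ X.piece b) (hy : y ∈ Y.piece c)
    (hz : z ∈ Z.piece d) :
    lin ((iso (tObj W X) Y Z).hom ≫ (iso W X (tObj Y Z)).hom) (tmk (tmk (tmk w x) y) z)
      = ((α (a * b) c d * α a b (c * d) : Rˣ) : R) • tmk w (tmk x (tmk y z)) := by
  simp [h _ _ _ _ _ _ _ (tmk_mem hw hx) _ hy _ hz, h _ _ _ _ _ _ _ hw _ hx _ (tmk_mem hy hz),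
    smul_smul]

end AssocIso

theorem AssocStr.HasScalars.pentagonScalars {A : AssocStr R G} {α : G → G → G → Rˣ}
    (h : A.HasScalars α) : PentagonScalars α := by
  intro a b c d
  have e := congrArg (fun f => lin f (tmk (tmk (tmk (gen R a) (gen R b)) (gen R c)) (gen R d)))
    (A.pentagon (simple R a) (simple R b) (simple R c) (simple R d))
  have e' := (pentagon_left h (gen_mem a) (gen_mem b) (gen_mem c) (gen_mem d)).symm.trans
    (e.trans (pentagon_right h (gen_mem a) (gen_mem b) (gen_mem c) (gen_mem d)))
  exact Units.ext (((isGenerator_gen a).tmk ((isGenerator_gen b).tmk ((isGenerator_gen c).tmk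
    (isGenerator_gen d)))).smul_inj e')

/-- The standard associativity isomorphism multiplied by `α`. -/
noncomputable def assocIso (α : G → G → G → Rˣ) (X Y Z : Obj R G) :
    tObj (tObj X Y) Z ≅ tObj X (tObj Y Z) := scaleIso₃ X Y Z α ≪≫ stdAssoc X Y Z

theorem assocIso_tmk (α : G → G → G → Rˣ) (X Y Z : Obj R G) (a b c : G) (x : X.carrier)
    (hx : x ∈ X.piece a) (y : Y.carrier) (hy : y ∈ Y.piece b) (z : Z.carrier)
    (hz : z ∈ Z.piece c) :
    lin (assocIso α X Y Z).hom (tmk (tmk x y) z) = (α a b c : R) • tmk x (tmk y z) := by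
  simp [assocIso, scaleIso₃_tmk α hx hy hz]

/-- The associativity structure given by scalars. -/
noncomputable def AssocStr.ofScalars (α : G → G → G → Rˣ) (hα : PentagonScalars α) :
    AssocStr R G where
  iso := assocIso α
  natural f g h := hom_ext (ext_tmk₃ fun a b c x hx y hy z hz => by
    simp [assocIso_tmk α _ _ _ _ _ _ _ hx _ hy _ hz,
      assocIso_tmk α _ _ _ _ _ _ _ (lin_mem f hx) _ (lin_mem g hy) _ (lin_mem h hz)])
  pentagon W X Y Z := hom_ext (ext_tmk₄ fun a b c d w hw x hx y hy z hz => by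
    rw [pentagon_left (assocIso_tmk α) hw hx hy hz, pentagon_right (assocIso_tmk α) hw hx hy hz,
      hα])

theorem AssocStr.ofScalars_hasScalars (α : G → G → G → Rˣ) (hα : PentagonScalars α) :
    (AssocStr.ofScalars α hα).HasScalars α := assocIso_tmk α

variable (R G) in
/-- Associativity structures are scalars that satisfy the pentagon identity. -/
noncomputable def assocEquiv : {α : G → G → G → Rˣ // PentagonScalars α} ≃ AssocStr R G :=
  Equiv.ofBijective (fun α => AssocStr.ofScalars α.1 α.2) ⟨fun α β h => by
      refine Subtype.ext (AssocStr.scalars_unique (AssocStr.ofScalars_hasScalars α.1 α.2) ?_)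
      change AssocStr.ofScalars α.1 α.2 = AssocStr.ofScalars β.1 β.2 at h
      rw [h]
      exact AssocStr.ofScalars_hasScalars β.1 β.2,
    fun A => by
      obtain ⟨α, hα⟩ := A.exists_scalars
      exact ⟨⟨α, hα.pentagonScalars⟩,
        AssocStr.ext_scalars (AssocStr.ofScalars_hasScalars α _) hα⟩⟩

theorem assocEquiv_hasScalars (α : {α : G → G → G → Rˣ // PentagonScalars α}) :
    (assocEquiv R G α).HasScalars α.1 := AssocStr.ofScalars_hasScalars α.1 α.2

/-! ### Automorphisms of the product -/

theorem ProductAut.exists_scalars (T : ProductAut R G) : ∃ μ, T.HasScalars μ := by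
  have h := fun a b => IsGenerator.exists_unit
    ((isGenerator_gen (R := R) a).tmk (isGenerator_gen b))
    ((isGenerator_gen a).tmk (isGenerator_gen b)) (T.iso (simple R a) (simple R b))
  choose μ hμ using h
  refine ⟨μ, fun X Y a b x hx y hy => ?_⟩
  have h1 := congrArg (fun f => lin f (tmk (gen R a) (gen R b)))
    (T.natural (ofElement x hx) (ofElement y hy))
  simpa [hμ] using h1

theorem ProductAut.scalars_unique {T : ProductAut R G} {μ ν : G → G → Rˣ} (hμ : T.HasScalars μ)
    (hν : T.HasScalars ν) : μ = ν := by
  funext a b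
  refine Units.ext (((isGenerator_gen (R := R) a).tmk (isGenerator_gen b)).smul_inj ?_)
  rw [← hμ _ _ a b _ (gen_mem a) _ (gen_mem b), ← hν _ _ a b _ (gen_mem a) _ (gen_mem b)]

theorem ProductAut.ext_scalars {T T' : ProductAut R G} {μ : G → G → Rˣ} (h : T.HasScalars μ)
    (h' : T'.HasScalars μ) : T = T' := by
  have e : T.iso = T'.iso := by
    funext X Y
    refine Iso.ext (hom_ext (ext_tmk₂ fun a b x hx y hy => ?_))
    rw [h X Y a b x hx y hy, h' X Y a b x hx y hy]
  cases T
  cases T'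
  cases e
  rfl

/-- The automorphism of the product given by scalars. -/
noncomputable def ProductAut.ofScalars (μ : G → G → Rˣ) : ProductAut R G where
  iso X Y := scaleIso₂ X Y μ
  natural f g := hom_ext (ext_tmk₂ fun a b x hx y hy => by
    simp [scaleIso₂_tmk μ hx hy, scaleIso₂_tmk μ (lin_mem f hx) (lin_mem g hy)])

theorem ProductAut.ofScalars_hasScalars (μ : G → G → Rˣ) :
    (ProductAut.ofScalars μ).HasScalars μ :=
  fun _ _ _ _ _ hx _ hy => scaleIso₂_tmk μ hx hy

variable (R G) in
/-- Automorphisms of the product are scalars. -/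
noncomputable def productAutEquiv : (G → G → Rˣ) ≃ ProductAut R G :=
  Equiv.ofBijective ProductAut.ofScalars ⟨fun μ ν h => by
      refine ProductAut.scalars_unique (ProductAut.ofScalars_hasScalars μ) ?_
      rw [h]
      exact ProductAut.ofScalars_hasScalars ν,
    fun T => by
      obtain ⟨μ, hμ⟩ := T.exists_scalars
      exact ⟨μ, ProductAut.ext_scalars (ProductAut.ofScalars_hasScalars μ) hμ⟩⟩

theorem productAutEquiv_hasScalars (μ : G → G → Rˣ) : (productAutEquiv R G μ).HasScalars μ :=
  ProductAut.ofScalars_hasScalars μ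

/-- Both composites send (x ⊗ y) ⊗ z to a multiple of x ⊗ (y ⊗ z). The coefficients are compared on
generators in one direction and on homogeneous pure tensors in the other. -/
theorem ProductAut.carriesAssoc_iff {T : ProductAut R G} {A A' : AssocStr R G}
    {μ : G → G → Rˣ} {α α' : G → G → G → Rˣ} (hT : T.HasScalars μ) (hA : A.HasScalars α)
    (hA' : A'.HasScalars α') :
    T.CarriesAssoc A A' ↔
      ∀ a b c, α a b c * (μ b c * μ a (b * c)) = μ a b * (μ (a * b) c * α' a b c) := by
  have hl : ∀ {X Y Z : Obj R G} {a b c : G} {x : X.carrier} {y : Y.carrier} {z : Z.carrier}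
      (_ : x ∈ X.piece a) (_ : y ∈ Y.piece b) (_ : z ∈ Z.piece c),
      lin ((A.iso X Y Z).hom ≫ tHom (𝟙 X) (T.iso Y Z).hom ≫ (T.iso X (tObj Y Z)).hom)
        (tmk (tmk x y) z)
        = ((α a b c * (μ b c * μ a (b * c)) : Rˣ) : R) • tmk x (tmk y z) := by
    intro X Y Z a b c x y z hx hy hz
    simp [hA _ _ _ _ _ _ _ hx _ hy _ hz, hT _ _ _ _ _ hy _ hz,
      hT _ _ _ _ _ hx _ (tmk_mem hy hz), smul_smul]
  have hr : ∀ {X Y Z : Obj R G} {a b c : G} {x : X.carrier} {y : Y.carrier} {z : Z.carrier}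
      (_ : x ∈ X.piece a) (_ : y ∈ Y.piece b) (_ : z ∈ Z.piece c),
      lin (tHom (T.iso X Y).hom (𝟙 Z) ≫ (T.iso (tObj X Y) Z).hom ≫ (A'.iso X Y Z).hom)
        (tmk (tmk x y) z)
        = ((μ a b * (μ (a * b) c * α' a b c) : Rˣ) : R) • tmk x (tmk y z) := by
    intro X Y Z a b c x y z hx hy hz
    simp [hA' _ _ _ _ _ _ _ hx _ hy _ hz, hT _ _ _ _ _ hx _ hy,
      hT _ _ _ _ _ (tmk_mem hx hy) _ hz, smul_smul]
  constructor
  · intro h a b c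
    have e := congrArg (fun f => lin f (tmk (tmk (gen R a) (gen R b)) (gen R c)))
      (h (simple R a) (simple R b) (simple R c))
    exact Units.ext (((isGenerator_gen a).tmk ((isGenerator_gen b).tmk
      (isGenerator_gen c))).smul_inj ((hl (gen_mem a) (gen_mem b) (gen_mem c)).symm.trans
        (e.trans (hr (gen_mem a) (gen_mem b) (gen_mem c)))))
  · intro h X Y Z
    refine hom_ext (ext_tmk₃ fun a b c x hx y hy z hz => ?_)
    rw [hl hx hy hz, hr hx hy hz, h]

/-! ### Braided and symmetric structures -/

theorem BraidedStr.exists_commScalars (B : BraidedStr R G) : ∃ τ, B.CommHasScalars τ := by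
  have h := fun a b => IsGenerator.exists_unit
    ((isGenerator_gen (R := R) a).tmk (isGenerator_gen b))
    ((isGenerator_gen b).tmk (isGenerator_gen a)) (B.comm (simple R a) (simple R b))
  choose τ hτ using h
  refine ⟨τ, fun X Y a b x hx y hy => ?_⟩
  have h1 := congrArg (fun f => lin f (tmk (gen R a) (gen R b)))
    (B.comm_natural (ofElement x hx) (ofElement y hy))
  simpa [hτ] using h1

theorem BraidedStr.commScalars_unique {B : BraidedStr R G} {σ τ : G → G → Rˣ}
    (hσ : B.CommHasScalars σ) (hτ : B.CommHasScalars τ) : σ = τ := by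
  funext a b
  refine Units.ext (((isGenerator_gen (R := R) b).tmk (isGenerator_gen a)).smul_inj ?_)
  rw [← hσ _ _ a b _ (gen_mem a) _ (gen_mem b), ← hτ _ _ a b _ (gen_mem a) _ (gen_mem b)]

theorem BraidedStr.ext_scalars {B B' : BraidedStr R G} {α : G → G → G → Rˣ} {τ : G → G → Rˣ}
    (hα : B.toAssocStr.HasScalars α) (hτ : B.CommHasScalars τ)
    (hα' : B'.toAssocStr.HasScalars α) (hτ' : B'.CommHasScalars τ) : B = B' := by
  have e : B.comm = B'.comm := by
    funext X Y
    refine Iso.ext (hom_ext (ext_tmk₂ fun a b x hx y hy => ?_))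
    rw [hτ X Y a b x hx y hy, hτ' X Y a b x hx y hy]
  have e' := AssocStr.ext_scalars hα hα'
  cases B
  cases B'
  cases e
  cases e'
  rfl

/-- The identity between scalars that is equivalent to the first hexagon axiom. -/
def HexagonForward {H : Type*} [CommGroup H] (α : G → G → G → H) (τ : G → G → H) : Prop :=
  ∀ a b c, α a b c * (τ a (b * c) * α b c a) = τ a b * (α b a c * τ a c)

/-- The identity between scalars that is equivalent to the second hexagon axiom. -/
def HexagonReverse {H : Type*} [CommGroup H] (α : G → G → G → H) (τ : G → G → H) : Prop :=
  ∀ a b c, (α a b c)⁻¹ * (τ (a * b) c * (α c a b)⁻¹) = τ b c * ((α a c b)⁻¹ * τ a c)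

section CommIso

variable {A : AssocStr R G} {comm : ∀ X Y : Obj R G, tObj X Y ≅ tObj Y X}
  {α : G → G → G → Rˣ} {τ : G → G → Rˣ}

theorem AssocStr.HasScalars.inv_apply (hA : A.HasScalars α) {X Y Z : Obj R G} {a b c : G}
    {x : X.carrier} {y : Y.carrier} {z : Z.carrier} (hx : x ∈ X.piece a) (hy : y ∈ Y.piece b)
    (hz : z ∈ Z.piece c) :
    lin (A.iso X Y Z).inv (tmk x (tmk y z)) = (((α a b c)⁻¹ : Rˣ) : R) • tmk (tmk x y) z :=
  lin_inv_of_lin_hom _ (hA _ _ _ _ _ _ _ hx _ hy _ hz)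

/-- The commutativity is a bare family, so that the equivalence serves both to derive the identity
from a braided structure and to construct such a structure. -/
theorem hexagon_forward_iff (hA : A.HasScalars α)
    (hc : ∀ (X Y : Obj R G) (a b : G), ∀ x ∈ X.piece a, ∀ y ∈ Y.piece b,
      lin (comm X Y).hom (tmk x y) = (τ a b : R) • tmk y x) :
    (∀ X Y Z : Obj R G, (A.iso X Y Z).hom ≫ (comm X (tObj Y Z)).hom ≫ (A.iso Y Z X).hom
      = tHom (comm X Y).hom (𝟙 Z) ≫ (A.iso Y X Z).hom ≫ tHom (𝟙 Y) (comm X Z).hom) ↔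
      HexagonForward α τ := by
  have hl : ∀ {X Y Z : Obj R G} {a b c : G} {x : X.carrier} {y : Y.carrier} {z : Z.carrier}
      (_ : x ∈ X.piece a) (_ : y ∈ Y.piece b) (_ : z ∈ Z.piece c),
      lin ((A.iso X Y Z).hom ≫ (comm X (tObj Y Z)).hom ≫ (A.iso Y Z X).hom)
        (tmk (tmk x y) z)
        = ((α a b c * (τ a (b * c) * α b c a) : Rˣ) : R) • tmk y (tmk z x) := by
    intro X Y Z a b c x y z hx hy hz
    simp [hA _ _ _ _ _ _ _ hx _ hy _ hz, hc _ _ _ _ _ hx _ (tmk_mem hy hz),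
      hA _ _ _ _ _ _ _ hy _ hz _ hx, smul_smul]
  have hr : ∀ {X Y Z : Obj R G} {a b c : G} {x : X.carrier} {y : Y.carrier} {z : Z.carrier}
      (_ : x ∈ X.piece a) (_ : y ∈ Y.piece b) (_ : z ∈ Z.piece c),
      lin (tHom (comm X Y).hom (𝟙 Z) ≫ (A.iso Y X Z).hom ≫ tHom (𝟙 Y) (comm X Z).hom)
        (tmk (tmk x y) z)
        = ((τ a b * (α b a c * τ a c) : Rˣ) : R) • tmk y (tmk z x) := by
    intro X Y Z a b c x y z hx hy hz
    simp [hA _ _ _ _ _ _ _ hy _ hx _ hz, hc _ _ _ _ _ hx _ hy, hc _ _ _ _ _ hx _ hz,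
      smul_smul]
  constructor
  · intro h a b c
    have e := congrArg (fun f => lin f (tmk (tmk (gen R a) (gen R b)) (gen R c)))
      (h (simple R a) (simple R b) (simple R c))
    exact Units.ext (((isGenerator_gen b).tmk ((isGenerator_gen c).tmk
      (isGenerator_gen a))).smul_inj ((hl (gen_mem a) (gen_mem b) (gen_mem c)).symm.trans
        (e.trans (hr (gen_mem a) (gen_mem b) (gen_mem c)))))
  · intro h X Y Z
    refine hom_ext (ext_tmk₃ fun a b c x hx y hy z hz => ?_)
    rw [hl hx hy hz, hr hx hy hz, h]

theorem hexagon_reverse_iff (hA : A.HasScalars α)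
    (hc : ∀ (X Y : Obj R G) (a b : G), ∀ x ∈ X.piece a, ∀ y ∈ Y.piece b,
      lin (comm X Y).hom (tmk x y) = (τ a b : R) • tmk y x) :
    (∀ X Y Z : Obj R G, (A.iso X Y Z).inv ≫ (comm (tObj X Y) Z).hom ≫ (A.iso Z X Y).inv
      = tHom (𝟙 X) (comm Y Z).hom ≫ (A.iso X Z Y).inv ≫ tHom (comm X Z).hom (𝟙 Y)) ↔
      HexagonReverse α τ := by
  have hl : ∀ {X Y Z : Obj R G} {a b c : G} {x : X.carrier} {y : Y.carrier} {z : Z.carrier}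
      (_ : x ∈ X.piece a) (_ : y ∈ Y.piece b) (_ : z ∈ Z.piece c),
      lin ((A.iso X Y Z).inv ≫ (comm (tObj X Y) Z).hom ≫ (A.iso Z X Y).inv)
        (tmk x (tmk y z))
        = (((α a b c)⁻¹ * (τ (a * b) c * (α c a b)⁻¹) : Rˣ) : R) • tmk (tmk z x) y := by
    intro X Y Z a b c x y z hx hy hz
    simp only [lin_comp, hA.inv_apply hx hy hz, hc _ _ _ _ _ (tmk_mem hx hy) _ hz,
      hA.inv_apply hz hx hy, map_smul, smul_smul, Units.val_mul]
  have hr : ∀ {X Y Z : Obj R G} {a b c : G} {x : X.carrier} {y : Y.carrier} {z : Z.carrier}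
      (_ : x ∈ X.piece a) (_ : y ∈ Y.piece b) (_ : z ∈ Z.piece c),
      lin (tHom (𝟙 X) (comm Y Z).hom ≫ (A.iso X Z Y).inv ≫ tHom (comm X Z).hom (𝟙 Y))
        (tmk x (tmk y z))
        = ((τ b c * ((α a c b)⁻¹ * τ a c) : Rˣ) : R) • tmk (tmk z x) y := by
    intro X Y Z a b c x y z hx hy hz
    simp only [lin_comp, lin_tHom, lin_id, hc _ _ _ _ _ hy _ hz, tmk_smul_right, map_smul,
      hA.inv_apply hx hz hy, hc _ _ _ _ _ hx _ hz, tmk_smul_left, smul_smul, Units.val_mul]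
  constructor
  · intro h a b c
    have e := congrArg (fun f => lin f (tmk (gen R a) (tmk (gen R b) (gen R c))))
      (h (simple R a) (simple R b) (simple R c))
    exact Units.ext ((((isGenerator_gen c).tmk (isGenerator_gen a)).tmk
      (isGenerator_gen b)).smul_inj ((hl (gen_mem a) (gen_mem b) (gen_mem c)).symm.trans
        (e.trans (hr (gen_mem a) (gen_mem b) (gen_mem c)))))
  · intro h X Y Z
    refine hom_ext (ext_tmk₃' fun a b c x hx y hy z hz => ?_)
    rw [hl hx hy hz, hr hx hy hz, h]

theorem symmetry_iff
    (hc : ∀ (X Y : Obj R G) (a b : G), ∀ x ∈ X.piece a, ∀ y ∈ Y.piece b,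
      lin (comm X Y).hom (tmk x y) = (τ a b : R) • tmk y x) :
    (∀ X Y : Obj R G, (comm X Y).hom ≫ (comm Y X).hom = 𝟙 (tObj X Y)) ↔
      ∀ a b, τ a b * τ b a = 1 := by
  have hl : ∀ {X Y : Obj R G} {a b : G} {x : X.carrier} {y : Y.carrier}
      (_ : x ∈ X.piece a) (_ : y ∈ Y.piece b),
      lin ((comm X Y).hom ≫ (comm Y X).hom) (tmk x y)
        = ((τ a b * τ b a : Rˣ) : R) • tmk x y := by
    intro X Y a b x y hx hy
    simp [hc _ _ _ _ _ hx _ hy, hc _ _ _ _ _ hy _ hx, smul_smul]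
  constructor
  · intro h a b
    have e := congrArg (fun f => lin f (tmk (gen R a) (gen R b))) (h (simple R a) (simple R b))
    refine Units.ext (((isGenerator_gen a).tmk (isGenerator_gen b)).smul_inj
      ((hl (gen_mem a) (gen_mem b)).symm.trans (e.trans ?_)))
    simp
  · intro h X Y
    refine hom_ext (ext_tmk₂ fun a b x hx y hy => ?_)
    rw [hl hx hy, h, Units.val_one, one_smul, lin_id]

end CommIso

/-- The standard commutativity isomorphism multiplied by `τ`. -/
noncomputable def commIso (hG : ∀ a b : G, a * b = b * a) (τ : G → G → Rˣ) (X Y : Obj R G) :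
    tObj X Y ≅ tObj Y X := scaleIso₂ X Y τ ≪≫ stdComm hG X Y

theorem commIso_tmk (hG : ∀ a b : G, a * b = b * a) (τ : G → G → Rˣ) (X Y : Obj R G) (a b : G)
    (x : X.carrier) (hx : x ∈ X.piece a) (y : Y.carrier) (hy : y ∈ Y.piece b) :
    lin (commIso hG τ X Y).hom (tmk x y) = (τ a b : R) • tmk y x := by
  simp [commIso, scaleIso₂_tmk τ hx hy]

/-- The scalars that correspond to braided structures. -/
def BraidedScalars {H : Type*} [CommGroup H] (p : (G → G → G → H) × (G → G → H)) : Prop :=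
  PentagonScalars p.1 ∧ HexagonForward p.1 p.2 ∧ HexagonReverse p.1 p.2

/-- The braided structure given by scalars. -/
noncomputable def BraidedStr.ofScalars (hG : ∀ a b : G, a * b = b * a)
    (p : (G → G → G → Rˣ) × (G → G → Rˣ)) (hp : BraidedScalars p) : BraidedStr R G where
  toAssocStr := AssocStr.ofScalars p.1 hp.1
  comm := commIso hG p.2
  comm_natural f g := hom_ext (ext_tmk₂ fun a b x hx y hy => by
    simp [commIso_tmk hG p.2 _ _ _ _ _ hx _ hy,
      commIso_tmk hG p.2 _ _ _ _ _ (lin_mem f hx) _ (lin_mem g hy)])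
  hexagon_forward := (hexagon_forward_iff (AssocStr.ofScalars_hasScalars p.1 hp.1)
    (commIso_tmk hG p.2)).2 hp.2.1
  hexagon_reverse := (hexagon_reverse_iff (AssocStr.ofScalars_hasScalars p.1 hp.1)
    (commIso_tmk hG p.2)).2 hp.2.2

theorem BraidedStr.ofScalars_hasScalars (hG : ∀ a b : G, a * b = b * a)
    (p : (G → G → G → Rˣ) × (G → G → Rˣ)) (hp : BraidedScalars p) :
    (BraidedStr.ofScalars hG p hp).toAssocStr.HasScalars p.1 ∧
      (BraidedStr.ofScalars hG p hp).CommHasScalars p.2 :=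
  ⟨AssocStr.ofScalars_hasScalars p.1 hp.1, commIso_tmk hG p.2⟩

theorem BraidedStr.braidedScalars (B : BraidedStr R G) {α : G → G → G → Rˣ} {τ : G → G → Rˣ}
    (hα : B.toAssocStr.HasScalars α) (hτ : B.CommHasScalars τ) : BraidedScalars (α, τ) :=
  ⟨hα.pentagonScalars, (hexagon_forward_iff hα hτ).1 B.hexagon_forward,
    (hexagon_reverse_iff hα hτ).1 B.hexagon_reverse⟩

variable (R) in
/-- Braided structures are scalars that satisfy the pentagon and hexagon identities. -/
noncomputable def braidedEquiv (hG : ∀ a b : G, a * b = b * a) :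
    {p : (G → G → G → Rˣ) × (G → G → Rˣ) // BraidedScalars p} ≃ BraidedStr R G :=
  Equiv.ofBijective (fun p => BraidedStr.ofScalars hG p.1 p.2) ⟨fun p q h => by
      change BraidedStr.ofScalars hG p.1 p.2 = BraidedStr.ofScalars hG q.1 q.2 at h
      have hp := BraidedStr.ofScalars_hasScalars hG p.1 p.2
      rw [h] at hp
      have hq := BraidedStr.ofScalars_hasScalars hG q.1 q.2
      exact Subtype.ext (Prod.ext (AssocStr.scalars_unique hp.1 hq.1)
        (BraidedStr.commScalars_unique hp.2 hq.2)),
    fun B => by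
      obtain ⟨α, hα⟩ := B.toAssocStr.exists_scalars
      obtain ⟨τ, hτ⟩ := B.exists_commScalars
      have h := BraidedStr.ofScalars_hasScalars hG (α, τ) (B.braidedScalars hα hτ)
      exact ⟨⟨(α, τ), B.braidedScalars hα hτ⟩, BraidedStr.ext_scalars h.1 h.2 hα hτ⟩⟩

theorem braidedEquiv_hasScalars (hG : ∀ a b : G, a * b = b * a)
    (p : {p : (G → G → G → Rˣ) × (G → G → Rˣ) // BraidedScalars p}) :
    (braidedEquiv R hG p).toAssocStr.HasScalars p.1.1 ∧
      (braidedEquiv R hG p).CommHasScalars p.1.2 :=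
  BraidedStr.ofScalars_hasScalars hG p.1 p.2

/-- Symmetry is a property of a braided structure, not additional data. -/
theorem SymmetricStr.toBraidedStr_injective :
    Function.Injective (SymmetricStr.toBraidedStr : SymmetricStr R G → BraidedStr R G) := by
  intro B B' h
  cases B
  cases B'
  cases h
  rfl

variable (R) in
/-- Symmetric structures are scalars that satisfy the pentagon, hexagon and symmetry identities. -/
noncomputable def symmetricEquiv (hG : ∀ a b : G, a * b = b * a) :
    {p : (G → G → G → Rˣ) × (G → G → Rˣ) //
      BraidedScalars p ∧ ∀ a b, p.2 a b * p.2 b a = 1} ≃ SymmetricStr R G :=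
  Equiv.ofBijective (fun p =>
      { toBraidedStr := BraidedStr.ofScalars hG p.1 p.2.1
        symmetry := (symmetry_iff (commIso_tmk hG p.1.2)).2 p.2.2 }) ⟨fun p q h => by
      have h' := congrArg SymmetricStr.toBraidedStr h
      have e := (braidedEquiv R hG).injective (a₁ := ⟨p.1, p.2.1⟩) (a₂ := ⟨q.1, q.2.1⟩) h'
      exact Subtype.ext (Subtype.mk.inj e),
    fun B => by
      obtain ⟨p, hp⟩ := (braidedEquiv R hG).surjective B.toBraidedStr
      have h := braidedEquiv_hasScalars hG p
      rw [hp] at h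
      exact ⟨⟨p.1, p.2, (symmetry_iff h.2).1 B.symmetry⟩,
        SymmetricStr.toBraidedStr_injective hp⟩⟩

theorem symmetricEquiv_hasScalars (hG : ∀ a b : G, a * b = b * a)
    (p : {p : (G → G → G → Rˣ) × (G → G → Rˣ) //
      BraidedScalars p ∧ ∀ a b, p.2 a b * p.2 b a = 1}) :
    (symmetricEquiv R hG p).toAssocStr.HasScalars p.1.1 ∧
      (symmetricEquiv R hG p).toBraidedStr.CommHasScalars p.1.2 :=
  BraidedStr.ofScalars_hasScalars hG p.1 p.2.1

theorem ProductAut.carriesBraided_iff {T : ProductAut R G} {B B' : BraidedStr R G}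
    {μ : G → G → Rˣ} {α α' : G → G → G → Rˣ} {τ τ' : G → G → Rˣ} (hT : T.HasScalars μ)
    (hα : B.toAssocStr.HasScalars α) (hτ : B.CommHasScalars τ)
    (hα' : B'.toAssocStr.HasScalars α') (hτ' : B'.CommHasScalars τ') :
    T.CarriesBraided B B' ↔
      (∀ a b c, α a b c * (μ b c * μ a (b * c)) = μ a b * (μ (a * b) c * α' a b c)) ∧
        ∀ a b, τ a b * μ b a = μ a b * τ' a b := by
  refine and_congr (T.carriesAssoc_iff hT hα hα') ⟨fun h a b => ?_, fun h X Y => ?_⟩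
  · have e := congrArg (fun f => lin f (tmk (gen R a) (gen R b))) (h (simple R a) (simple R b))
    refine Units.ext (((isGenerator_gen b).tmk (isGenerator_gen a)).smul_inj ?_)
    simpa [hT _ _ _ _ _ (gen_mem a) _ (gen_mem b), hT _ _ _ _ _ (gen_mem b) _ (gen_mem a),
      hτ _ _ _ _ _ (gen_mem a) _ (gen_mem b), hτ' _ _ _ _ _ (gen_mem a) _ (gen_mem b),
      smul_smul] using e
  · refine hom_ext (ext_tmk₂ fun a b x hx y hy => ?_)
    simp only [lin_comp, hT _ _ _ _ _ hx _ hy, hT _ _ _ _ _ hy _ hx, hτ _ _ _ _ _ hx _ hy,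
      hτ' _ _ _ _ _ hx _ hy, map_smul, smul_smul, ← Units.val_mul, h]

/-! ### Unit isomorphisms -/

theorem span_gen (g : G) : Submodule.span R {gen R g} = ⊤ := by
  rw [eq_top_iff]
  intro r _
  exact Submodule.mem_span_singleton.2 ⟨r, mul_one (M := R) r⟩

/-- The pieces of a simple object outside its own degree vanish. This settles the wrong degrees when
the unit isomorphisms are checked to preserve the grading. -/
theorem eq_smul_gen {g a : G} {r : (simple R g).carrier} (hr : r ∈ (simple R g).piece a) :
    ∃ s : R, r = s • gen R g ∧ (a = g ∨ s = 0) := by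
  by_cases h : a = g
  · exact ⟨r, (mul_one (M := R) r).symm, Or.inl h⟩
  · have h1 : ((⨆ (_ : a = g), ⊤) : Submodule R R) = ⊥ := iSup_neg h
    have h2 : r ∈ ((⨆ (_ : a = g), ⊤) : Submodule R R) := hr
    exact ⟨r, (mul_one (M := R) r).symm, Or.inr ((Submodule.mem_bot R).1 (h1.le h2))⟩

/-- The standard left unit isomorphism of modules. -/
noncomputable def leftUnitLin (X : Obj R G) : (tObj (simple R 1) X).carrier ≃ₗ[R] X.carrier :=
  TensorProduct.lid R X.carrier

@[simp] theorem leftUnitLin_gen {X : Obj R G} (x : X.carrier) :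
    leftUnitLin X (tmk (gen R 1) x) = x := one_smul R x

/-- The standard right unit isomorphism of modules. -/
noncomputable def rightUnitLin (X : Obj R G) : (tObj X (simple R 1)).carrier ≃ₗ[R] X.carrier :=
  TensorProduct.rid R X.carrier

@[simp] theorem rightUnitLin_gen {X : Obj R G} (x : X.carrier) :
    rightUnitLin X (tmk x (gen R 1)) = x := one_smul R x

/-- The standard left unit isomorphism. -/
noncomputable def stdLeftUnit (X : Obj R G) : tObj (simple R 1) X ≅ X :=
  isoOfLin (leftUnitLin X).toLinearMap (leftUnitLin X).symm.toLinearMap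
    (fun g => map_mem_of_tmk _ (by
      rintro a b rfl r hr x hx
      obtain ⟨s, rfl, rfl | rfl⟩ := eq_smul_gen hr
      · simpa using Submodule.smul_mem _ s hx
      · rw [tmk_smul_left, zero_smul, map_zero]
        exact Submodule.zero_mem _))
    (fun g x hx => by
      have h : (leftUnitLin X).symm x = tmk (gen R 1) x := by
        rw [LinearEquiv.symm_apply_eq, leftUnitLin_gen]
      rw [LinearEquiv.coe_coe, h]
      simpa using tmk_mem (gen_mem (R := R) (1 : G)) hx)
    (LinearMap.ext fun t => (leftUnitLin X).symm_apply_apply t)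
    (LinearMap.ext fun t => (leftUnitLin X).apply_symm_apply t)

@[simp] theorem stdLeftUnit_gen {X : Obj R G} (x : X.carrier) :
    lin (stdLeftUnit X).hom (tmk (gen R 1) x) = x := leftUnitLin_gen x

/-- The standard right unit isomorphism. -/
noncomputable def stdRightUnit (X : Obj R G) : tObj X (simple R 1) ≅ X :=
  isoOfLin (rightUnitLin X).toLinearMap (rightUnitLin X).symm.toLinearMap
    (fun g => map_mem_of_tmk _ (by
      rintro a b rfl x hx r hr
      obtain ⟨s, rfl, rfl | rfl⟩ := eq_smul_gen hr
      · simpa using Submodule.smul_mem _ s hx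
      · rw [tmk_smul_right, zero_smul, map_zero]
        exact Submodule.zero_mem _))
    (fun g x hx => by
      have h : (rightUnitLin X).symm x = tmk x (gen R 1) := by
        rw [LinearEquiv.symm_apply_eq, rightUnitLin_gen]
      rw [LinearEquiv.coe_coe, h]
      simpa using tmk_mem hx (gen_mem (R := R) (1 : G)))
    (LinearMap.ext fun t => (rightUnitLin X).symm_apply_apply t)
    (LinearMap.ext fun t => (rightUnitLin X).apply_symm_apply t)

@[simp] theorem stdRightUnit_gen {X : Obj R G} (x : X.carrier) :
    lin (stdRightUnit X).hom (tmk x (gen R 1)) = x := rightUnitLin_gen x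

/-- In the pentagon at (a,1,1,b) the value α(a,1,b) occurs once on the left and twice on the right;
one copy cancels. -/
theorem PentagonScalars.middle_one {α : G → G → G → Rˣ} (h : PentagonScalars α) (a b : G) :
    α a 1 b = α a 1 1 * α 1 1 b := by
  have e := h a 1 1 b
  simp only [mul_one, one_mul] at e
  rw [mul_right_comm] at e
  exact (mul_right_cancel e).symm

theorem AssocStr.nonempty_unitStr (A : AssocStr R G) : Nonempty (UnitStr A) := by
  obtain ⟨α, hα⟩ := A.exists_scalars
  exact ⟨{
    -- The triangle axiom requires α(a,1,b) times the left scalar at b to equal the right scalar at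
    -- a; `PentagonScalars.middle_one` factors α(a,1,b) accordingly.
    left := fun X => stdLeftUnit X ≪≫ scaleIso₁ X fun a => (α 1 1 a)⁻¹
    right := fun X => stdRightUnit X ≪≫ scaleIso₁ X fun a => α a 1 1
    left_natural := fun {X Y} f => hom_ext (LinearMap.ext_on
      (span_tmk (span_gen 1) X.span_homogeneous) (by
        rintro _ ⟨_, rfl, x, ⟨a, hx⟩, rfl⟩
        simp [scaleIso₁_apply _ hx, scaleIso₁_apply _ (lin_mem f hx)]))
    right_natural := fun {X Y} f => hom_ext (LinearMap.ext_on
      (span_tmk X.span_homogeneous (span_gen 1)) (by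
        rintro _ ⟨x, ⟨a, hx⟩, _, rfl, rfl⟩
        simp [scaleIso₁_apply _ hx, scaleIso₁_apply _ (lin_mem f hx)]))
    triangle := fun X Y => hom_ext (LinearMap.ext_on
      (span_tmk (span_tmk X.span_homogeneous (span_gen 1)) Y.span_homogeneous) (by
        rintro _ ⟨_, ⟨x, ⟨a, hx⟩, _, rfl, rfl⟩, y, ⟨b, hy⟩, rfl⟩
        simp [hα _ _ _ _ _ _ _ hx _ (gen_mem 1) _ hy, scaleIso₁_apply _ hx,
          scaleIso₁_apply _ hy, hα.pentagonScalars.middle_one a b, smul_smul])) }⟩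

end Structures

/-! ### Evaluation of cochains on chains -/

open Finsupp

@[simp] theorem mapDomain_neg {S T : Type*} (f : S → T) (c : S →₀ ℤ) :
    (-c).mapDomain f = -c.mapDomain f := map_neg (mapDomain.addMonoidHom (M := ℤ) f) c

@[simp] theorem mapDomain_sub {S T : Type*} (f : S → T) (c d : S →₀ ℤ) :
    (c - d).mapDomain f = c.mapDomain f - d.mapDomain f := by
  rw [sub_eq_add_neg, mapDomain_add, mapDomain_neg, sub_eq_add_neg]

namespace CellData

variable {S : Type v} {A : CellData S} {P : S → Prop} {H : Type u} [CommGroup H] {n : ℕ}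

/-- The value of a cochain on a chain. -/
noncomputable def Cochain.eval (f : A.Cochain P H n) (c : S →₀ ℤ) : H :=
  c.prod fun y k => f.onCell y ^ k

@[simp] theorem Cochain.eval_single (f : A.Cochain P H n) (x : S) :
    f.eval (single x 1) = f.onCell x := by
  simp [Cochain.eval]

@[simp] theorem Cochain.eval_add (f : A.Cochain P H n) (c d : S →₀ ℤ) :
    f.eval (c + d) = f.eval c * f.eval d :=
  Finsupp.prod_add_index' (fun _ => zpow_zero _) (fun _ => zpow_add _)

@[simp] theorem Cochain.eval_neg (f : A.Cochain P H n) (c : S →₀ ℤ) :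
    f.eval (-c) = (f.eval c)⁻¹ := by
  refine eq_inv_of_mul_eq_one_left ?_
  rw [← Cochain.eval_add, neg_add_cancel]
  exact Finsupp.prod_zero_index

@[simp] theorem Cochain.eval_sub (f : A.Cochain P H n) (c d : S →₀ ℤ) :
    f.eval (c - d) = f.eval c * (f.eval d)⁻¹ := by
  rw [sub_eq_add_neg, Cochain.eval_add, Cochain.eval_neg]

theorem Cochain.onCell_val (f : A.Cochain P H n) (x : A.NCell P n) : f.onCell x.1 = f x := by
  rw [Cochain.onCell, dif_pos x.2]

theorem mem_cocycles_iff (f : A.Cochain P H n) :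
    f ∈ A.cocycles P H n ↔ ∀ x : A.NCell P (n + 1), f.eval (A.bd x.1) = 1 :=
  funext_iff

/-- Both ends of Δ¹ omit the cell of positive dimension and contribute nothing. Only the boundary of
the cell remains, with the sign of passing Δ¹. -/
theorem bar_bd_singleton {x : S} (hx : A.dim x ≠ 0) :
    A.bar.bd [x] = -(A.bd x).mapDomain fun y => [y] := by
  simp [bar, barBd, Finset.sum_range_succ, face, tupleBd, hx]

end CellData

/-! ### Boundaries and products of cells of low dimension -/

section Cells

variable {G : Type v} [Group G]

theorem B1_dim (l : List G) : (B1 G).dim l = l.length := by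
  have h : (discrete G).tupleDim l = 0 := by simp [CellData.tupleDim, discrete]
  change l.length + (discrete G).tupleDim l = l.length
  rw [h, add_zero]

theorem B1_bd_three (a b c : G) : (B1 G).bd [a, b, c] =
    single [b, c] 1 - single [a * b, c] 1 + single [a, b * c] 1 - single [a, b] 1 := by
  simp [B1, CellData.bar, CellData.barBd, Finset.sum_range_succ, CellData.face,
    CellData.tupleBd, discrete, mapDomain_single]
  abel

/-- Both ends of the edge are the unique vertex, so they cancel. -/
theorem B1_bd_one (a : G) : (B1 G).bd [a] = 0 := by
  simp [B1, CellData.bar, CellData.barBd, Finset.sum_range_succ, CellData.face,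
    CellData.tupleBd, discrete]

theorem B1_bd_two (a b : G) : (B1 G).bd [a, b] =
    single [b] 1 - single [a * b] 1 + single [a] 1 := by
  simp [B1, CellData.bar, CellData.barBd, Finset.sum_range_succ, CellData.face,
    CellData.tupleBd, discrete, mapDomain_single]
  abel

theorem B1_bd_four (a b c d : G) : (B1 G).bd [a, b, c, d] =
    single [b, c, d] 1 - single [a * b, c, d] 1 + single [a, b * c, d] 1
      - single [a, b, c * d] 1 + single [a, b, c] 1 := by
  simp [B1, CellData.bar, CellData.barBd, Finset.sum_range_succ, CellData.face,
    CellData.tupleBd, discrete, mapDomain_single]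
  abel

theorem B1_mul_one_one (a b : G) : (B1 G).mul [a] [b] = single [a, b] 1 - single [b, a] 1 := by
  simp [B1, CellData.bar, CellData.barMul, CellData.shuffle, discrete, CellData.tupleDim,
    mapDomain_single]
  abel

theorem B1_mul_one_two (a b c : G) : (B1 G).mul [a] [b, c] =
    single [a, b, c] 1 - single [b, a, c] 1 + single [b, c, a] 1 := by
  simp [B1, CellData.bar, CellData.barMul, CellData.shuffle, discrete, CellData.tupleDim,
    mapDomain_single]
  simp [mapDomain_add, mapDomain_neg, mapDomain_single]
  abel

theorem B1_mul_two_one (a b c : G) : (B1 G).mul [a, b] [c] =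
    single [a, b, c] 1 - single [a, c, b] 1 + single [c, a, b] 1 := by
  simp [B1, CellData.bar, CellData.barMul, CellData.shuffle, discrete, CellData.tupleDim,
    mapDomain_single]
  simp [mapDomain_add, mapDomain_neg, mapDomain_single]
  abel

theorem B2_dim (L : List (List G)) : (B2 G).dim L = L.length + (L.map List.length).sum := by
  change L.length + (L.map (B1 G).dim).sum = _
  rw [funext B1_dim]

theorem B2_bd_singleton {l : List G} (hl : l ≠ []) :
    (B2 G).bd [l] = -((B1 G).bd l).mapDomain fun m => [m] :=
  CellData.bar_bd_singleton (by simpa [B1_dim] using hl)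

/-- The outer faces of Δ² omit a cell of positive dimension and vanish. The middle face gives the
product with sign -1, and the boundary of the product cell passes Δ² without a sign. -/
theorem B2_bd_pair {l m : List G} (hl : l ≠ []) (hm : m ≠ []) :
    (B2 G).bd [l, m] = -((B1 G).mul l m).mapDomain (fun t => [t])
      + (((B1 G).bd l).mapDomain (fun t => [t, m])
        + (-1 : ℤ) ^ l.length • ((B1 G).bd m).mapDomain fun t => [l, t]) := by
  simp [B2, CellData.bar, CellData.barBd, Finset.sum_range_succ, CellData.face,
    CellData.tupleBd, hl, hm, B1_dim, ← mapDomain_comp]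
  rfl

theorem B2_bd_three (a b c : G) : (B2 G).bd [[a, b, c]] =
    -(single [[b, c]] 1 - single [[a * b, c]] 1 + single [[a, b * c]] 1 - single [[a, b]] 1) := by
  simp [B2_bd_singleton, B1_bd_three, mapDomain_add, mapDomain_single]

theorem B2_bd_four (a b c d : G) : (B2 G).bd [[a, b, c, d]] =
    -(single [[b, c, d]] 1 - single [[a * b, c, d]] 1 + single [[a, b * c, d]] 1
      - single [[a, b, c * d]] 1 + single [[a, b, c]] 1) := by
  simp [B2_bd_singleton, B1_bd_four, mapDomain_add, mapDomain_single]

theorem B2_bd_one_one (a b : G) : (B2 G).bd [[a], [b]] =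
    -single [[a, b]] 1 + single [[b, a]] 1 := by
  simp [B2_bd_pair, B1_mul_one_one, B1_bd_one, mapDomain_single]
  abel

/-- The first bracket comes from the three shuffles of (a) with (b,c), the second from the boundary
of (b,c). A cocycle condition on this chain is the first hexagon for σ⁻¹; the analogous cell
((a,b),(c)) gives the second. -/
theorem B2_bd_one_two (a b c : G) : (B2 G).bd [[a], [b, c]] =
    -(single [[a, b, c]] 1 - single [[b, a, c]] 1 + single [[b, c, a]] 1)
      - (single [[a], [c]] 1 - single [[a], [b * c]] 1 + single [[a], [b]] 1) := by
  simp [B2_bd_pair, B1_mul_one_two, B1_bd_one, B1_bd_two, mapDomain_add, mapDomain_single]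
  abel

theorem B2_bd_two_one (a b c : G) : (B2 G).bd [[a, b], [c]] =
    -(single [[a, b, c]] 1 - single [[a, c, b]] 1 + single [[c, a, b]] 1)
      + (single [[b], [c]] 1 - single [[a * b], [c]] 1 + single [[a], [c]] 1) := by
  simp [B2_bd_pair, B1_mul_two_one, B1_bd_one, B1_bd_two, mapDomain_add, mapDomain_single]

theorem B3_dim (L : List (List (List G))) :
    (B3 G).dim L = L.length + (L.map fun X => X.length + (X.map List.length).sum).sum := by
  change L.length + (L.map (B2 G).dim).sum = _
  rw [funext B2_dim]

theorem B3_bd_singleton {X : List (List G)} (hX : X ≠ []) :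
    (B3 G).bd [X] = -((B2 G).bd X).mapDomain fun Y => [Y] :=
  CellData.bar_bd_singleton (by simp [B2_dim, hX])

theorem B2_bd_one (a : G) : (B2 G).bd [[a]] = 0 := by
  simp [B2_bd_singleton, B1_bd_one]

/-- For the transposed shuffle the parity sign and the sign for exchanging two 1-cells cancel, so
both terms have equal signs, in contrast to `B1_mul_one_one`. This is what yields symmetry on B³_G.
-/
theorem B2_mul_one_one (a b : G) :
    (B2 G).mul [[a]] [[b]] = -(single [[a], [b]] 1 + single [[b], [a]] 1) := by
  simp [B2, CellData.bar, CellData.barMul, CellData.shuffle, B1_dim, CellData.tupleDim,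
    mapDomain_single]
  abel

theorem B3_bd_one_one (a b : G) :
    (B3 G).bd [[[a]], [[b]]] = single [[[a], [b]]] 1 + single [[[b], [a]]] 1 := by
  have h : ∀ c : G, (B2 G).dim [[c]] ≠ 0 := fun c => by simp [B2_dim]
  have h1 : (B3 G).bd [[[a]], [[b]]] = -((B2 G).mul [[a]] [[b]]).mapDomain fun t => [t] := by
    simp [B3, CellData.bar, CellData.barBd, Finset.sum_range_succ, CellData.face,
      CellData.tupleBd, h, B2_bd_one]
  rw [h1, B2_mul_one_one]
  simp [mapDomain_add, mapDomain_single]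

/-! ### Classification of cells of low dimension -/

theorem B1_cell_two {l : List G} (h : (B1 G).dim l = 2) : ∃ a b, l = [a, b] := by
  rw [B1_dim] at h
  exact List.length_eq_two.1 h

theorem B1_cell_three {l : List G} (h : (B1 G).dim l = 3) : ∃ a b c, l = [a, b, c] := by
  rw [B1_dim] at h
  exact List.length_eq_three.1 h

theorem length_eq_four {G : Type*} {l : List G} (h : l.length = 4) : ∃ a b c d, l = [a, b, c, d] := by
  obtain ⟨a, t, rfl⟩ := List.exists_cons_of_length_eq_add_one h
  obtain ⟨b, c, d, rfl⟩ := List.length_eq_three.1 (Nat.succ.inj h)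
  exact ⟨a, b, c, d, rfl⟩

/-- Each nonempty entry contributes at least 2: its own length and one simplex direction. Three
entries already give dimension 6, beyond the range needed. -/
theorem Nontriv2.dim_cases {L : List (List G)} (hL : Nontriv2 L) :
    L = [] ∨ (∃ l, L = [l] ∧ 1 ≤ l.length ∧ (B2 G).dim L = 1 + l.length) ∨
      (∃ l m, L = [l, m] ∧ 1 ≤ l.length ∧ 1 ≤ m.length ∧
        (B2 G).dim L = 2 + l.length + m.length) ∨ 6 ≤ (B2 G).dim L := by
  have hp : ∀ x ∈ L, 1 ≤ x.length := fun x hx => List.length_pos_iff.2 (hL x hx)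
  match L, hp with
  | [], _ => exact Or.inl rfl
  | [l], hp => exact Or.inr (Or.inl ⟨l, rfl, hp l (by simp), by simp [B2_dim]⟩)
  | [l, m], hp =>
    exact Or.inr (Or.inr (Or.inl ⟨l, m, rfl, hp l (by simp), hp m (by simp), by
      simp [B2_dim]; omega⟩))
  | l :: m :: k :: t, hp =>
    have h1 := hp l (by simp)
    have h2 := hp m (by simp)
    have h3 := hp k (by simp)
    refine Or.inr (Or.inr (Or.inr ?_))
    simp [B2_dim]
    omega

theorem B2_cell_three {L : List (List G)} (hL : Nontriv2 L) (h : (B2 G).dim L = 3) :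
    ∃ a b, L = [[a, b]] := by
  rcases hL.dim_cases with rfl | ⟨l, rfl, h1, h2⟩ | ⟨l, m, rfl, h1, h2, h3⟩ | h1
  · simp [B2_dim] at h
  · obtain ⟨a, b, rfl⟩ := List.length_eq_two.1 (show l.length = 2 by omega)
    exact ⟨a, b, rfl⟩
  · omega
  · omega

theorem B2_cell_four {L : List (List G)} (hL : Nontriv2 L) (h : (B2 G).dim L = 4) :
    (∃ a b c, L = [[a, b, c]]) ∨ ∃ a b, L = [[a], [b]] := by
  rcases hL.dim_cases with rfl | ⟨l, rfl, h1, h2⟩ | ⟨l, m, rfl, h1, h2, h3⟩ | h1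
  · simp [B2_dim] at h
  · obtain ⟨a, b, c, rfl⟩ := List.length_eq_three.1 (show l.length = 3 by omega)
    exact Or.inl ⟨a, b, c, rfl⟩
  · obtain ⟨a, rfl⟩ := List.length_eq_one_iff.1 (show l.length = 1 by omega)
    obtain ⟨b, rfl⟩ := List.length_eq_one_iff.1 (show m.length = 1 by omega)
    exact Or.inr ⟨a, b, rfl⟩
  · omega

theorem B2_cell_five {L : List (List G)} (hL : Nontriv2 L) (h : (B2 G).dim L = 5) :
    (∃ a b c d, L = [[a, b, c, d]]) ∨ (∃ a b c, L = [[a], [b, c]]) ∨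
      ∃ a b c, L = [[a, b], [c]] := by
  rcases hL.dim_cases with rfl | ⟨l, rfl, h1, h2⟩ | ⟨l, m, rfl, h1, h2, h3⟩ | h1
  · simp [B2_dim] at h
  · obtain ⟨a, b, c, d, rfl⟩ := length_eq_four (show l.length = 4 by omega)
    exact Or.inl ⟨a, b, c, d, rfl⟩
  · rcases (show l.length = 1 ∧ m.length = 2 ∨ l.length = 2 ∧ m.length = 1 by omega) with
      ⟨hl, hm⟩ | ⟨hl, hm⟩
    · obtain ⟨a, rfl⟩ := List.length_eq_one_iff.1 hl
      obtain ⟨b, c, rfl⟩ := List.length_eq_two.1 hm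
      exact Or.inr (Or.inl ⟨a, b, c, rfl⟩)
    · obtain ⟨a, b, rfl⟩ := List.length_eq_two.1 hl
      obtain ⟨c, rfl⟩ := List.length_eq_one_iff.1 hm
      exact Or.inr (Or.inr ⟨a, b, c, rfl⟩)
  · omega

theorem B2_dim_two_le {X : List (List G)} (hX : X ≠ [] ∧ Nontriv2 X) :
    2 ≤ (B2 G).dim X ∧ ((B2 G).dim X = 2 → ∃ a, X = [[a]]) := by
  rcases hX.2.dim_cases with rfl | ⟨l, rfl, h1, h2⟩ | ⟨l, m, rfl, h1, h2, h3⟩ | h1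
  · exact absurd rfl hX.1
  · refine ⟨by omega, fun h => ?_⟩
    obtain ⟨a, rfl⟩ := List.length_eq_one_iff.1 (show l.length = 1 by omega)
    exact ⟨a, rfl⟩
  · exact ⟨by omega, fun h => by omega⟩
  · exact ⟨by omega, fun h => by omega⟩

/-- Each entry contributes at least 3. Two entries reach dimension 6 only when both are of the form
((a)), and three entries give at least 9. -/
theorem Nontriv3.dim_cases {L : List (List (List G))} (hL : Nontriv3 L) :
    L = [] ∨ (∃ X, L = [X] ∧ Nontriv2 X ∧ (B3 G).dim L = 1 + (B2 G).dim X) ∨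
      (∃ a b, L = [[[a]], [[b]]]) ∨ 7 ≤ (B3 G).dim L := by
  have hd : (B3 G).dim L = L.length + (L.map (B2 G).dim).sum := rfl
  rw [hd]
  have hp : ∀ X ∈ L, X ≠ [] ∧ Nontriv2 X := hL
  match L, hp with
  | [], _ => exact Or.inl rfl
  | [X], hp => exact Or.inr (Or.inl ⟨X, rfl, (hp X (by simp)).2, by simp⟩)
  | [X, Y], hp =>
    have h1 := B2_dim_two_le (hp X (by simp))
    have h2 := B2_dim_two_le (hp Y (by simp))
    by_cases h : (B2 G).dim X = 2 ∧ (B2 G).dim Y = 2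
    · obtain ⟨a, rfl⟩ := h1.2 h.1
      obtain ⟨b, rfl⟩ := h2.2 h.2
      exact Or.inr (Or.inr (Or.inl ⟨a, b, rfl⟩))
    · refine Or.inr (Or.inr (Or.inr ?_))
      simp
      omega
  | X :: Y :: Z :: t, hp =>
    have h1 := (B2_dim_two_le (hp X (by simp))).1
    have h2 := (B2_dim_two_le (hp Y (by simp))).1
    have h3 := (B2_dim_two_le (hp Z (by simp))).1
    refine Or.inr (Or.inr (Or.inr ?_))
    simp
    omega

theorem B3_cell_five {L : List (List (List G))} (hL : Nontriv3 L) (h : (B3 G).dim L = 5) :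
    (∃ a b c, L = [[[a, b, c]]]) ∨ ∃ a b, L = [[[a], [b]]] := by
  rcases hL.dim_cases with rfl | ⟨X, rfl, hX, h1⟩ | ⟨a, b, rfl⟩ | h1
  · simp [B3_dim] at h
  · rcases B2_cell_four hX (by omega) with ⟨a, b, c, rfl⟩ | ⟨a, b, rfl⟩
    · exact Or.inl ⟨a, b, c, rfl⟩
    · exact Or.inr ⟨a, b, rfl⟩
  · simp [B3_dim] at h
  · omega

theorem B3_cell_six {L : List (List (List G))} (hL : Nontriv3 L) (h : (B3 G).dim L = 6) :
    (∃ X, L = [X] ∧ Nontriv2 X ∧ (B2 G).dim X = 5) ∨ ∃ a b, L = [[[a]], [[b]]] := by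
  rcases hL.dim_cases with rfl | ⟨X, rfl, hX, h1⟩ | ⟨a, b, rfl⟩ | h1
  · simp [B3_dim] at h
  · exact Or.inl ⟨X, rfl, hX, by omega⟩
  · exact Or.inr ⟨a, b, rfl⟩
  · omega

/-! ### Cochains as functions -/

variable {H : Type u} [CommGroup H]

theorem B1_cochain_two_bijective : Function.Bijective
    fun (f : (B1 G).Cochain Nontriv1 H 2) a b => f (cell1_2 a b) := by
  refine ⟨fun f g h => ?_, fun μ => ?_⟩
  · funext ⟨l, hl⟩
    obtain ⟨a, b, rfl⟩ := B1_cell_two hl.2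
    exact congrFun (congrFun h a) b
  -- The default value is immaterial: every cell of this dimension has the first shape.
  · exact ⟨fun x => match x.1 with
      | [a, b] => μ a b
      | _ => 1, rfl⟩

theorem B1_cochain_three_bijective : Function.Bijective
    fun (f : (B1 G).Cochain Nontriv1 H 3) a b c => f (cell1_3 a b c) := by
  refine ⟨fun f g h => ?_, fun α => ?_⟩
  · funext ⟨l, hl⟩
    obtain ⟨a, b, c, rfl⟩ := B1_cell_three hl.2
    exact congrFun (congrFun (congrFun h a) b) c
  · exact ⟨fun x => match x.1 with
      | [a, b, c] => α a b c
      | _ => 1, rfl⟩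

theorem B2_cochain_three_bijective : Function.Bijective
    fun (f : (B2 G).Cochain Nontriv2 H 3) a b => f (cell2_2 a b) := by
  refine ⟨fun f g h => ?_, fun μ => ?_⟩
  · funext ⟨l, hl⟩
    obtain ⟨a, b, rfl⟩ := B2_cell_three hl.1 hl.2
    exact congrFun (congrFun h a) b
  · exact ⟨fun x => match x.1 with
      | [[a, b]] => μ a b
      | _ => 1, rfl⟩

theorem B2_cochain_four_bijective : Function.Bijective
    fun (f : (B2 G).Cochain Nontriv2 H 4) =>
      ((fun a b c => f (cell2_3 a b c), fun a b => f (cell2_11 a b)) :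
        (G → G → G → H) × (G → G → H)) := by
  refine ⟨fun f g h => ?_, fun p => ?_⟩
  · obtain ⟨h1, h2⟩ := Prod.mk.inj h
    funext ⟨l, hl⟩
    rcases B2_cell_four hl.1 hl.2 with ⟨a, b, c, rfl⟩ | ⟨a, b, rfl⟩
    · exact congrFun (congrFun (congrFun h1 a) b) c
    · exact congrFun (congrFun h2 a) b
  · exact ⟨fun x => match x.1 with
      | [[a, b, c]] => p.1 a b c
      | [[a], [b]] => p.2 a b
      | _ => 1, rfl⟩

theorem B3_cochain_five_bijective : Function.Bijective
    fun (f : (B3 G).Cochain Nontriv3 H 5) =>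
      ((fun a b c => f (cell3_3 a b c), fun a b => f (cell3_11 a b)) :
        (G → G → G → H) × (G → G → H)) := by
  refine ⟨fun f g h => ?_, fun p => ?_⟩
  · obtain ⟨h1, h2⟩ := Prod.mk.inj h
    funext ⟨l, hl⟩
    rcases B3_cell_five hl.1 hl.2 with ⟨a, b, c, rfl⟩ | ⟨a, b, rfl⟩
    · exact congrFun (congrFun (congrFun h1 a) b) c
    · exact congrFun (congrFun h2 a) b
  · exact ⟨fun x => match x.1 with
      | [[[a, b, c]]] => p.1 a b c
      | [[[a], [b]]] => p.2 a b
      | _ => 1, rfl⟩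

end Cells

/-! ### Cocycle conditions as identities between scalars -/

section Cocycles

variable {G : Type v} [Group G] {H : Type u} [CommGroup H]

theorem eq_one_iff_of_eq_div {x p q : H} (h : x = p / q) : x = 1 ↔ p = q := by
  rw [h, div_eq_one]

theorem eq_one_iff_of_eq_div' {x p q : H} (h : x = q / p) : x = 1 ↔ p = q := by
  rw [h, div_eq_one, eq_comm]

open CellData.Cochain in
theorem B1_coboundary (μ : (B1 G).Cochain Nontriv1 H 2) (a b c : G) :
    (B1 G).coboundary Nontriv1 H 2 μ (cell1_3 a b c) =
      μ (cell1_2 b c) * (μ (cell1_2 (a * b) c))⁻¹ * μ (cell1_2 a (b * c)) *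
        (μ (cell1_2 a b))⁻¹ := by
  have h : ∀ a b, μ.onCell [a, b] = μ (cell1_2 a b) := fun a b => onCell_val μ (cell1_2 a b)
  change μ.eval ((B1 G).bd [a, b, c]) = _
  simp only [B1_bd_three, eval_add, eval_sub, eval_single, h]

open CellData.Cochain in
-- The outer inverse is the sign from Δ¹. It is the reason why μ acts on the product through μ⁻¹.
theorem B2_coboundary_three (μ : (B2 G).Cochain Nontriv2 H 3) (a b c : G) :
    (B2 G).coboundary Nontriv2 H 3 μ (cell2_3 a b c) =
      (μ (cell2_2 b c) * (μ (cell2_2 (a * b) c))⁻¹ * μ (cell2_2 a (b * c)) *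
        (μ (cell2_2 a b))⁻¹)⁻¹ := by
  have h : ∀ a b, μ.onCell [[a, b]] = μ (cell2_2 a b) := fun a b => onCell_val μ (cell2_2 a b)
  change μ.eval ((B2 G).bd [[a, b, c]]) = _
  simp only [B2_bd_three, eval_add, eval_sub, eval_neg, eval_single, h]

open CellData.Cochain in
theorem B2_coboundary_one_one (μ : (B2 G).Cochain Nontriv2 H 3) (a b : G) :
    (B2 G).coboundary Nontriv2 H 3 μ (cell2_11 a b) =
      (μ (cell2_2 a b))⁻¹ * μ (cell2_2 b a) := by
  have h : ∀ a b, μ.onCell [[a, b]] = μ (cell2_2 a b) := fun a b => onCell_val μ (cell2_2 a b)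
  change μ.eval ((B2 G).bd [[a], [b]]) = _
  simp only [B2_bd_one_one, eval_add, eval_neg, eval_single, h]

open CellData.Cochain in
theorem B1_mem_cocycles_iff (f : (B1 G).Cochain Nontriv1 H 3) :
    f ∈ (B1 G).cocycles Nontriv1 H 3 ↔ PentagonScalars fun a b c => f (cell1_3 a b c) := by
  have h : ∀ a b c, f.onCell [a, b, c] = f (cell1_3 a b c) :=
    fun a b c => onCell_val f (cell1_3 a b c)
  have key : ∀ a b c d, f.eval ((B1 G).bd [a, b, c, d]) = 1 ↔
      f (cell1_3 a b c) * f (cell1_3 a (b * c) d) * f (cell1_3 b c d) =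
        f (cell1_3 (a * b) c d) * f (cell1_3 a b (c * d)) := by
    intro a b c d
    -- Additive notation makes the remaining identity in a commutative group accessible to `abel`.
    refine eq_one_iff_of_eq_div (Additive.ofMul.injective ?_)
    simp only [B1_bd_four, eval_add, eval_sub, eval_single, h, ofMul_mul, ofMul_inv, ofMul_div]
    abel
  rw [CellData.mem_cocycles_iff]
  refine ⟨fun hf a b c d => (key a b c d).1 (hf ⟨[a, b, c, d], trivial, rfl⟩), ?_⟩
  rintro hf ⟨l, hl⟩
  obtain ⟨a, b, c, d, rfl⟩ := length_eq_four ((B1_dim l).symm.trans hl.2)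
  exact (key a b c d).2 (hf a b c d)

/-- The scalars of the associativity and commutativity isomorphisms that belong to a pair of
functions on cells. -/
def braidedScalarsEquiv : ((G → G → G → H) × (G → G → H)) ≃ ((G → G → G → H) × (G → G → H)) :=
  (Equiv.refl _).prodCongr (Equiv.inv _)

/-- The values of a function of `4`-chains of `B²_G` on the boundaries of the `5`-cells are trivial
precisely if the pentagon and hexagon identities hold. -/
theorem braidedScalars_iff (e : (List (List G) →₀ ℤ) → H) (α : G → G → G → H) (σ : G → G → H)
    (hadd : ∀ c d, e (c + d) = e c * e d) (hneg : ∀ c, e (-c) = (e c)⁻¹)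
    (hα : ∀ a b c, e (Finsupp.single [[a, b, c]] 1) = α a b c)
    (hσ : ∀ a b, e (Finsupp.single [[a], [b]] 1) = σ a b) :
    (∀ L, Nontriv2 L → (B2 G).dim L = 5 → e ((B2 G).bd L) = 1) ↔
      BraidedScalars (braidedScalarsEquiv (α, σ)) := by
  -- Only additivity of `e` and its values on 4-cells enter. Thus the computation serves cochains on
  -- B²_G and, after suspension, those on B³_G.
  have k1 : ∀ a b c d, e ((B2 G).bd [[a, b, c, d]]) = 1 ↔
      α a b c * α a (b * c) d * α b c d = α (a * b) c d * α a b (c * d) := by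
    intro a b c d
    refine eq_one_iff_of_eq_div' (Additive.ofMul.injective ?_)
    simp only [B2_bd_four, sub_eq_add_neg, hadd, hneg, hα, ofMul_mul, ofMul_inv, ofMul_div]
    abel
  have k2 : ∀ a b c, e ((B2 G).bd [[a], [b, c]]) = 1 ↔
      α a b c * ((σ a (b * c))⁻¹ * α b c a) = (σ a b)⁻¹ * (α b a c * (σ a c)⁻¹) := by
    intro a b c
    refine eq_one_iff_of_eq_div' (Additive.ofMul.injective ?_)
    simp only [B2_bd_one_two, sub_eq_add_neg, hadd, hneg, hα, hσ, ofMul_mul, ofMul_inv,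
      ofMul_div]
    abel
  have k3 : ∀ a b c, e ((B2 G).bd [[a, b], [c]]) = 1 ↔
      (α a b c)⁻¹ * ((σ (a * b) c)⁻¹ * (α c a b)⁻¹) =
        (σ b c)⁻¹ * ((α a c b)⁻¹ * (σ a c)⁻¹) := by
    intro a b c
    refine eq_one_iff_of_eq_div (Additive.ofMul.injective ?_)
    simp only [B2_bd_two_one, sub_eq_add_neg, hadd, hneg, hα, hσ, ofMul_mul, ofMul_inv,
      ofMul_div]
    abel
  constructor
  · exact fun h => ⟨fun a b c d => (k1 a b c d).1 (h _ (by simp [Nontriv2]) rfl),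
      fun a b c => (k2 a b c).1 (h _ (by simp [Nontriv2]) rfl),
      fun a b c => (k3 a b c).1 (h _ (by simp [Nontriv2]) rfl)⟩
  · rintro ⟨h1, h2, h3⟩ L hL hd
    rcases B2_cell_five hL hd with ⟨a, b, c, d, rfl⟩ | ⟨a, b, c, rfl⟩ | ⟨a, b, c, rfl⟩
    · exact (k1 a b c d).2 (h1 a b c d)
    · exact (k2 a b c).2 (h2 a b c)
    · exact (k3 a b c).2 (h3 a b c)

theorem B2_mem_cocycles_iff (f : (B2 G).Cochain Nontriv2 H 4) :
    f ∈ (B2 G).cocycles Nontriv2 H 4 ↔ BraidedScalars (braidedScalarsEquiv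
      ((fun a b c => f (cell2_3 a b c), fun a b => f (cell2_11 a b)))) := by
  rw [CellData.mem_cocycles_iff, ← braidedScalars_iff f.eval _ _ f.eval_add f.eval_neg
    (fun a b c => (f.eval_single _).trans (f.onCell_val (cell2_3 a b c)))
    (fun a b => (f.eval_single _).trans (f.onCell_val (cell2_11 a b)))]
  exact ⟨fun h L hL hd => h ⟨L, hL, hd⟩, fun h x => h x.1 x.2.1 x.2.2⟩

/-- The 6-cells are the suspensions of the 5-cells of B²_G, whose boundary changes only by a sign,
and the cells ((a)),((b)). The former give the braided identities, the latter symmetry. -/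
theorem B3_mem_cocycles_iff (f : (B3 G).Cochain Nontriv3 H 5) :
    f ∈ (B3 G).cocycles Nontriv3 H 5 ↔
      (fun p : (G → G → G → H) × (G → G → H) =>
        BraidedScalars p ∧ ∀ a b, p.2 a b * p.2 b a = 1) (braidedScalarsEquiv
      ((fun a b c => f (cell3_3 a b c), fun a b => f (cell3_11 a b)))) := by
  have hσ : ∀ a b, f.eval (Finsupp.single [[[a], [b]]] 1) = f (cell3_11 a b) :=
    fun a b => (f.eval_single _).trans (f.onCell_val (cell3_11 a b))
  have hs : ∀ a b, f.eval ((B3 G).bd [[[a]], [[b]]]) = 1 ↔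
      (f (cell3_11 a b))⁻¹ * (f (cell3_11 b a))⁻¹ = 1 := by
    intro a b
    rw [B3_bd_one_one, f.eval_add, hσ, hσ, ← mul_inv, inv_eq_one]
  -- Precomposition with suspension of chains turns a 5-cochain on B³_G into a function of 4-chains
  -- of B²_G.
  have hb := braidedScalars_iff (fun c => f.eval (c.mapDomain fun Y => [Y]))
    (fun a b c => f (cell3_3 a b c)) (fun a b => f (cell3_11 a b))
    (fun c d => by rw [Finsupp.mapDomain_add, f.eval_add])
    (fun c => by rw [mapDomain_neg, f.eval_neg])
    (fun a b c => by
      rw [Finsupp.mapDomain_single]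
      exact (f.eval_single _).trans (f.onCell_val (cell3_3 a b c)))
    (fun a b => by rw [Finsupp.mapDomain_single, hσ])
  have h1 : ∀ X : List (List G), (B2 G).dim X = 5 → (f.eval ((B3 G).bd [X]) = 1 ↔
      f.eval (((B2 G).bd X).mapDomain fun Y => [Y]) = 1) := by
    intro X hX
    rw [B3_bd_singleton (by rintro rfl; simp [B2_dim] at hX), f.eval_neg, inv_eq_one]
  rw [CellData.mem_cocycles_iff]
  change _ ↔ BraidedScalars _ ∧ _
  rw [← hb]
  constructor
  · refine fun h => ⟨fun L hL hd => (h1 L hd).1 (h ⟨[L], ?_, ?_⟩),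
      fun a b => (hs a b).1 (h ⟨[[[a]], [[b]]], by simp [Nontriv3, Nontriv2], rfl⟩)⟩
    · have hne : L ≠ [] := by rintro rfl; simp [B2_dim] at hd
      simpa [Nontriv3] using And.intro hne hL
    · change 1 + ((B2 G).dim L + 0) = 6
      rw [hd]
  · rintro ⟨h2, h3⟩ ⟨L, hL, hd⟩
    rcases B3_cell_six hL hd with ⟨X, rfl, hX, h5⟩ | ⟨a, b, rfl⟩
    · exact (h1 X h5).2 (h2 X hX h5)
    · exact (hs a b).2 (h3 a b)

/-! ### Coboundaries are cocycles -/

theorem B1_coboundaries_le :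
    (B1 G).coboundaries Nontriv1 H 2 ≤ (B1 G).cocycles Nontriv1 H 3 := by
  rintro _ ⟨μ, rfl⟩
  rw [B1_mem_cocycles_iff]
  intro a b c d
  -- Associativity is also needed inside G, to identify the arguments (ab)c and a(bc).
  simp only [B1_coboundary, mul_assoc]
  refine Additive.ofMul.injective ?_
  simp only [ofMul_mul, ofMul_inv]
  abel

/-- On the mixed 5-cells the terms cancel only after identifying arguments such as ab and ba; this
is where commutativity of G enters. -/
theorem B2_coboundaries_le (hG : ∀ a b : G, a * b = b * a) :
    (B2 G).coboundaries Nontriv2 H 3 ≤ (B2 G).cocycles Nontriv2 H 4 := by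
  rintro _ ⟨μ, rfl⟩
  rw [B2_mem_cocycles_iff]
  refine ⟨fun a b c d => ?_, fun a b c => ?_, fun a b c => ?_⟩
  · simp only [braidedScalarsEquiv, Equiv.prodCongr_apply, Prod.map, Equiv.refl_apply,
      B2_coboundary_three, mul_assoc]
    refine Additive.ofMul.injective ?_
    simp only [ofMul_mul, ofMul_inv]
    abel
  · simp only [braidedScalarsEquiv, Equiv.prodCongr_apply, Prod.map, Equiv.refl_apply,
      Equiv.inv_apply, Pi.inv_apply, B2_coboundary_three, B2_coboundary_one_one]
    rw [hG b a, hG c a]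
    refine Additive.ofMul.injective ?_
    simp only [ofMul_mul, ofMul_inv]
    abel
  · simp only [braidedScalarsEquiv, Equiv.prodCongr_apply, Prod.map, Equiv.refl_apply,
      Equiv.inv_apply, Pi.inv_apply, B2_coboundary_three, B2_coboundary_one_one]
    rw [hG c a, hG c b]
    refine Additive.ofMul.injective ?_
    simp only [ofMul_mul, ofMul_inv]
    abel

/-! ### Bijections from cochains and cocycles to scalars, and the coboundary relation -/

variable (G H) in
/-- `3`-cocycles on `B_G` as functions. -/
noncomputable def cocycleEquiv₁ :
    (B1 G).cocycles Nontriv1 H 3 ≃ {α : G → G → G → H // PentagonScalars α} :=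
  (Equiv.ofBijective _ B1_cochain_three_bijective).subtypeEquiv B1_mem_cocycles_iff

variable (G H) in
/-- `4`-cocycles on `B²_G` as pairs of functions. -/
noncomputable def cocycleEquiv₂ : (B2 G).cocycles Nontriv2 H 4 ≃
    {p : (G → G → G → H) × (G → G → H) // BraidedScalars p} :=
  ((Equiv.ofBijective _ B2_cochain_four_bijective).trans braidedScalarsEquiv).subtypeEquiv
    B2_mem_cocycles_iff

variable (G H) in
/-- `5`-cocycles on `B³_G` as pairs of functions. -/
noncomputable def cocycleEquiv₃ : (B3 G).cocycles Nontriv3 H 5 ≃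
    {p : (G → G → G → H) × (G → G → H) // BraidedScalars p ∧ ∀ a b, p.2 a b * p.2 b a = 1} :=
  ((Equiv.ofBijective _ B3_cochain_five_bijective).trans braidedScalarsEquiv).subtypeEquiv
    B3_mem_cocycles_iff

variable (G H) in
/-- `2`-cochains on `B_G` as functions. -/
noncomputable def cochainEquiv₁ : (B1 G).Cochain Nontriv1 H 2 ≃ (G → G → H) :=
  Equiv.ofBijective _ B1_cochain_two_bijective

variable (G H) in
/-- `3`-cochains on `B²_G` as functions, inverted. -/
noncomputable def cochainEquiv₂ : (B2 G).Cochain Nontriv2 H 3 ≃ (G → G → H) :=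
  (Equiv.ofBijective _ B2_cochain_three_bijective).trans (Equiv.inv _)

/-- The coboundary relation is cleared of inverses to match the identity in
`ProductAut.carriesAssoc_iff`. -/
theorem eq_mul_coboundary_iff₁ (μ : (B1 G).Cochain Nontriv1 H 2)
    (z z' : (B1 G).Cochain Nontriv1 H 3) :
    z' = z * (B1 G).coboundary Nontriv1 H 2 μ ↔ ∀ a b c,
      z (cell1_3 a b c) * (μ (cell1_2 b c) * μ (cell1_2 a (b * c))) =
        μ (cell1_2 a b) * (μ (cell1_2 (a * b) c) * z' (cell1_3 a b c)) := by
  rw [← B1_cochain_three_bijective.injective.eq_iff]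
  simp only [funext_iff, Pi.mul_apply, B1_coboundary]
  refine forall_congr' fun a => forall_congr' fun b => forall_congr' fun c => ?_
  rw [← div_eq_one]
  refine eq_one_iff_of_eq_div' (Additive.ofMul.injective ?_)
  simp only [ofMul_mul, ofMul_inv, ofMul_div]
  abel

/-- The inverses of μ and of the values on ((a),(b)) are kept because they are the scalars of the
automorphism and of the commutativity, as in `ProductAut.carriesBraided_iff`. -/
theorem eq_mul_coboundary_iff₂ (μ : (B2 G).Cochain Nontriv2 H 3)
    (z z' : (B2 G).Cochain Nontriv2 H 4) :
    z' = z * (B2 G).coboundary Nontriv2 H 3 μ ↔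
      (∀ a b c, z (cell2_3 a b c) * ((μ (cell2_2 b c))⁻¹ * (μ (cell2_2 a (b * c)))⁻¹) =
        (μ (cell2_2 a b))⁻¹ * ((μ (cell2_2 (a * b) c))⁻¹ * z' (cell2_3 a b c))) ∧
      ∀ a b, (z (cell2_11 a b))⁻¹ * (μ (cell2_2 b a))⁻¹ =
        (μ (cell2_2 a b))⁻¹ * (z' (cell2_11 a b))⁻¹ := by
  rw [← B2_cochain_four_bijective.injective.eq_iff, Prod.mk.injEq]
  simp only [funext_iff, Pi.mul_apply, B2_coboundary_three, B2_coboundary_one_one]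
  refine and_congr (forall_congr' fun a => forall_congr' fun b => forall_congr' fun c => ?_)
    (forall_congr' fun a => forall_congr' fun b => ?_)
  · rw [← div_eq_one]
    refine eq_one_iff_of_eq_div' (Additive.ofMul.injective ?_)
    simp only [ofMul_mul, ofMul_inv, ofMul_div]
    abel
  · rw [← div_eq_one]
    refine eq_one_iff_of_eq_div (Additive.ofMul.injective ?_)
    simp only [ofMul_mul, ofMul_inv, ofMul_div]
    abel

end Cocycles

end GroupCat

/-! ### Assembly: cocycles and structures compared through their scalars -/

theorem mainTheorem10 (R : Type u) [CommRing R] (G : Type v) [Group G] :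
    -- every associativity structure extends to a monoidal structure
    (∀ A : GroupCat.AssocStr R G, Nonempty (GroupCat.UnitStr A)) ∧
    -- (1) 3-cocycles on `B_G` are associativity structures, and 2-cochains are self-transformations
    ((GroupCat.B1 G).coboundaries GroupCat.Nontriv1 Rˣ 2
        ≤ (GroupCat.B1 G).cocycles GroupCat.Nontriv1 Rˣ 3 ∧
      ∃ (Φ : (GroupCat.B1 G).cocycles GroupCat.Nontriv1 Rˣ 3 ≃ GroupCat.AssocStr R G)
        (Ψ : (GroupCat.B1 G).Cochain GroupCat.Nontriv1 Rˣ 2 ≃ GroupCat.ProductAut R G),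
        (∀ z, (Φ z).HasScalars fun a b c => z.1 (GroupCat.cell1_3 a b c)) ∧
        (∀ μ, (Ψ μ).HasScalars fun a b => μ (GroupCat.cell1_2 a b)) ∧
        ∀ μ z z', z'.1 = z.1 * (GroupCat.B1 G).coboundary GroupCat.Nontriv1 Rˣ 2 μ ↔
          (Ψ μ).CarriesAssoc (Φ z) (Φ z')) ∧
    ((∀ a b : G, a * b = b * a) →
      -- (2) 4-cocycles on `B²_G` are braided structures, and 3-cochains are self-transformations
      ((GroupCat.B2 G).coboundaries GroupCat.Nontriv2 Rˣ 3
          ≤ (GroupCat.B2 G).cocycles GroupCat.Nontriv2 Rˣ 4 ∧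
        ∃ (Φ : (GroupCat.B2 G).cocycles GroupCat.Nontriv2 Rˣ 4 ≃ GroupCat.BraidedStr R G)
          (Ψ : (GroupCat.B2 G).Cochain GroupCat.Nontriv2 Rˣ 3 ≃ GroupCat.ProductAut R G),
          (∀ z, (Φ z).toAssocStr.HasScalars (fun a b c => z.1 (GroupCat.cell2_3 a b c)) ∧
            (Φ z).CommHasScalars fun a b => (z.1 (GroupCat.cell2_11 a b))⁻¹) ∧
          (∀ μ, (Ψ μ).HasScalars fun a b => (μ (GroupCat.cell2_2 a b))⁻¹) ∧
          ∀ μ z z', z'.1 = z.1 * (GroupCat.B2 G).coboundary GroupCat.Nontriv2 Rˣ 3 μ ↔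
            (Ψ μ).CarriesBraided (Φ z) (Φ z')) ∧
      -- (3) 5-cocycles on `B³_G` are symmetric structures
      ∃ Φ : (GroupCat.B3 G).cocycles GroupCat.Nontriv3 Rˣ 5 ≃ GroupCat.SymmetricStr R G,
        ∀ z, (Φ z).toAssocStr.HasScalars (fun a b c => z.1 (GroupCat.cell3_3 a b c)) ∧
          (Φ z).toBraidedStr.CommHasScalars fun a b => (z.1 (GroupCat.cell3_11 a b))⁻¹) := by
  refine ⟨GroupCat.AssocStr.nonempty_unitStr, ⟨GroupCat.B1_coboundaries_le,
    (GroupCat.cocycleEquiv₁ G Rˣ).trans (GroupCat.assocEquiv R G),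
    (GroupCat.cochainEquiv₁ G Rˣ).trans (GroupCat.productAutEquiv R G),
    fun z => GroupCat.assocEquiv_hasScalars _, fun μ => GroupCat.productAutEquiv_hasScalars _,
    fun μ z z' => ?_⟩, fun hG => ⟨⟨GroupCat.B2_coboundaries_le hG,
    (GroupCat.cocycleEquiv₂ G Rˣ).trans (GroupCat.braidedEquiv R hG),
    (GroupCat.cochainEquiv₂ G Rˣ).trans (GroupCat.productAutEquiv R G),
    fun z => GroupCat.braidedEquiv_hasScalars hG _,
    fun μ => GroupCat.productAutEquiv_hasScalars _, fun μ z z' => ?_⟩,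
    (GroupCat.cocycleEquiv₃ G Rˣ).trans (GroupCat.symmetricEquiv R hG),
    fun z => GroupCat.symmetricEquiv_hasScalars hG _⟩⟩
  -- The coboundary relation and compatibility with the associativities are the same identity
  -- between units.
  · exact (GroupCat.eq_mul_coboundary_iff₁ μ z.1 z'.1).trans
      (GroupCat.ProductAut.carriesAssoc_iff
        (GroupCat.productAutEquiv_hasScalars (GroupCat.cochainEquiv₁ G Rˣ μ))
        (GroupCat.assocEquiv_hasScalars (GroupCat.cocycleEquiv₁ G Rˣ z))
        (GroupCat.assocEquiv_hasScalars (GroupCat.cocycleEquiv₁ G Rˣ z'))).symm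
  · have hz := GroupCat.braidedEquiv_hasScalars hG (GroupCat.cocycleEquiv₂ G Rˣ z)
    have hz' := GroupCat.braidedEquiv_hasScalars hG (GroupCat.cocycleEquiv₂ G Rˣ z')
    exact (GroupCat.eq_mul_coboundary_iff₂ μ z.1 z'.1).trans
      (GroupCat.ProductAut.carriesBraided_iff
        (GroupCat.productAutEquiv_hasScalars (GroupCat.cochainEquiv₂ G Rˣ μ)) hz.1 hz.2 hz'.1 hz'.2).symm
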